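/- Fix a finite $n \ge 3$. A \emph{generalised $n$-gon} is a bipartite graph, with the two sides called points and lines and adjacency called incidence, of girth $2n$ and diameter $n$. A generalised $n$-gon with domain $\omega$ is coded by the set of its points and its symmetric incidence relation, i.e. by an element of the Polish space $2^{\omega}\times 2^{\omega\times\omega}$; isomorphisms are the bijections preserving points, lines and incidence. Graphs (irreflexive and symmetric) with domain $\omega$ are coded by elements of $2^{\omega\times\omega}$. \textbf{Theorem.} For every finite $n\ge 3$, the space of generalised $n$-gons with domain $\omega$ is Borel complete. That is, it is a Borel subset of $2^{\omega}\times 2^{\omega\times\omega}$, and its isomorphism relation is as complex as isomorphism of countable graphs: the isomorphism relation on generalised $n$-gons with domain $\omega$ and the isomorphism relation on graphs with domain $\omega$ are Borel reducible to each other, where an equivalence relation $E$ on $X$ is Borel reducible to $F$ on $Y$ if there is a Borel map $f:X\to Y$ such that $x\,E\,y \iff f(x)\,F\,f(y)$ for all $x,y\in X$. -/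

import Mathlib

/-- A generalised `n`-gon: a bipartite graph with set of points `P` and set of lines `Pᶜ`, whose
edges are the incident pairs, of girth `2n` and diameter `n`. -/
structure IsGeneralisedPolygon {V : Type*} (n : ℕ) (P : Set V) (G : SimpleGraph V) : Prop where
  bipartite : G.IsBipartiteWith P Pᶜ
  girth : G.egirth = 2 * (n : ℕ∞)
  diameter : G.ediam = (n : ℕ∞)

/-- `E` is Borel reducible to `F`. -/
def BorelReducible {X Y : Type*} [MeasurableSpace X] [MeasurableSpace Y]
    (E : X → X → Prop) (F : Y → Y → Prop) : Prop :=
  ∃ f : X → Y, Measurable f ∧ ∀ x y, E x y ↔ F (f x) (f y)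

/-- Codes of binary relations on `ω`: the Cantor space `2 ^ (ω × ω)`. The measurable space
structure is the product one, which is the Borel σ-algebra of the product topology. -/
abbrev RelCode : Type := ℕ → ℕ → Bool

/-- The space of (irreflexive, symmetric) graphs with domain `ω`. -/
def graphsOnNat : Set RelCode :=
  {E | (∀ a, E a a = false) ∧ ∀ a b, E a b = E b a}

/-- Isomorphism of two binary relations on `ω`. -/
def RelCode.Iso (E F : RelCode) : Prop :=
  ∃ σ : Equiv.Perm ℕ, ∀ a b, E a b = F (σ a) (σ b)

/-- Structures with domain `ω` for the two-sorted language of points and lines: the first component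
tells which elements are points (the others being lines), the second is the incidence relation. -/
abbrev PointLineCode : Type := (ℕ → Bool) × RelCode

/-- Isomorphism of point-line structures: it preserves the sorts and incidence. -/
def PointLineCode.Iso (S T : PointLineCode) : Prop :=
  ∃ σ : Equiv.Perm ℕ, (∀ a, S.1 a = T.1 (σ a)) ∧ ∀ a b, S.2 a b = T.2 (σ a) (σ b)

/-- The space of generalised `n`-gons with domain `ω`. -/
def generalisedPolygonsOnNat (n : ℕ) : Set PointLineCode :=
  {S | ∃ G : SimpleGraph ℕ, (∀ a b, G.Adj a b ↔ S.2 a b = true) ∧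
    IsGeneralisedPolygon n {a | S.1 a = true} G}

/-- A class `C` of codes of countable structures, with isomorphism relation `iso`, is Borel complete:
`C` is a Borel set, and isomorphism on `C` is exactly as complex, with respect to Borel reducibility,
as isomorphism of graphs with domain `ω`. -/
structure IsBorelComplete {X : Type*} [MeasurableSpace X] (C : Set X) (iso : X → X → Prop) :
    Prop where
  measurableSet : MeasurableSet C
  graphs_reducible : BorelReducible
    (fun E F : graphsOnNat => RelCode.Iso E.1 F.1) (fun S T : C => iso S.1 T.1)
  reducible_graphs : BorelReducible
    (fun S T : C => iso S.1 T.1) (fun E F : graphsOnNat => RelCode.Iso E.1 F.1)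

/-! The hard direction rests on free completion. Start from a bipartite graph without cycles shorter
than 2n and, stage after stage, add a path of length n - 1 between any two vertices whose colours
have the right parity but which are more than n - 1 apart. By parity such vertices are at distance
at least n + 1, or in different components, so every new cycle has length at least 2n
(`IsPathSystem.longPeriods`). In the limit, vertices of the right parity are within n - 1 of each
other, hence all vertices are within n (`IsPartialPolygon.within_completionAdj`).

The starting graph can be recovered if each of its vertices lies in a finite subgraph of minimal
degree at least three. Interior vertices of the paths added last have degree two, so, descending
through the stages, such a subgraph of the completion lies in the starting graph
(`IsPartialPolygon.inCore_completionAdj_iff`).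

A graph R on ω is turned into a starting graph `Base` as follows. There are vertices `pt a` and, for
every ordered pair (a, b), a chain of 2n + 1 vertices whose last one is always joined to `pt b` and
whose first one is joined to `pt a` exactly when R a b; the vertex set thus does not depend on R. A
copy of a finite cubic bipartite graph of girth more than 2n is glued to every vertex. The `pt a`
are then the vertices of infinite degree, and R says which of them are joined through vertices of
finite degree (`Base.rel_iff_linked`). Isomorphisms of graphs extend to the completions by acting on
the names of the vertices (`ColorIso.stage_lift`), and the construction is Borel because all names
lie in one countable set.

In the other direction a triangle joined to all points turns a polygon into a graph. The space is
Borel because girth and diameter can be expressed by quantifying over finite lists. -/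

/-! ### Cycles, girth and diameter. -/

open SimpleGraph in
/-- Two distinct paths with the same ends enclose a cycle. -/
theorem SimpleGraph.Walk.IsPath.egirth_le_of_ne {V : Type*} {G : SimpleGraph V} {u v : V}
    {p q : G.Walk u v} (hp : p.IsPath) (hq : q.IsPath) (hne : p ≠ q) :
    G.egirth ≤ (p.length + q.length : ℕ) := by
  classical
  -- `H` consists of the edges of the two paths. It is not acyclic, since paths in a forest are
  -- unique, and a cycle in it has at most as many edges as both paths together.
  set H : SimpleGraph V := fromEdgeSet {e | e ∈ p.edges ∨ e ∈ q.edges} with hH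
  have hmem : ∀ e, e ∈ G.edgeSet → (e ∈ p.edges ∨ e ∈ q.edges) → e ∈ H.edgeSet := by
    intro e he h
    rw [hH, edgeSet_fromEdgeSet]
    exact ⟨h, G.not_isDiag_of_mem_edgeSet he⟩
  have hpH : ∀ e ∈ p.edges, e ∈ H.edgeSet := fun e he =>
    hmem e (p.edges_subset_edgeSet he) (Or.inl he)
  have hqH : ∀ e ∈ q.edges, e ∈ H.edgeSet := fun e he =>
    hmem e (q.edges_subset_edgeSet he) (Or.inr he)
  have hHG : H ≤ G := by
    rw [← edgeSet_subset_edgeSet]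
    intro e he
    rw [hH, edgeSet_fromEdgeSet] at he
    rcases he.1 with h | h
    exacts [p.edges_subset_edgeSet h, q.edges_subset_edgeSet h]
  have hnac : ¬ H.IsAcyclic := by
    intro hac
    have := congrArg Subtype.val
      ((hac.subsingleton_path u v).elim ⟨p.transfer H hpH, hp.transfer hpH⟩
        ⟨q.transfer H hqH, hq.transfer hqH⟩)
    apply hne
    apply Walk.ext_support
    have h2 := congrArg Walk.support this
    simpa using h2
  obtain ⟨a, w, hw, hl⟩ := exists_egirth_eq_length.2 hnac
  calc G.egirth ≤ H.egirth := egirth_anti hHG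
    _ = w.length := hl
    _ ≤ (p.length + q.length : ℕ) := by
      norm_cast
      rw [← w.length_edges, ← List.toFinset_card_of_nodup hw.edges_nodup, ← p.length_edges,
        ← q.length_edges]
      calc w.edges.toFinset.card ≤ (p.edges.toFinset ∪ q.edges.toFinset).card := by
            apply Finset.card_le_card
            intro e he
            have := w.edges_subset_edgeSet (List.mem_toFinset.1 he)
            rw [hH, edgeSet_fromEdgeSet] at this
            simpa using this.1
        _ ≤ _ := (Finset.card_union_le _ _).trans
            (add_le_add (List.toFinset_card_le _) (List.toFinset_card_le _))

/-- Every periodic walk without backtracking has period at least `m`. -/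
def LongPeriods {V : Type*} (E : V → V → Prop) (m : ℕ) : Prop :=
  ∀ (k : ℕ) (w : ℕ → V), 0 < k → (∀ i, E (w i) (w (i + 1))) → (∀ i, w i ≠ w (i + 2)) →
    (∀ i, w (i + k) = w i) → m ≤ k

-- A cycle run round for ever is a periodic walk without backtracking; only the passage through its
-- base vertex needs separate care.
open SimpleGraph in
theorem LongPeriods.le_length_of_isCycle {V : Type*} {G : SimpleGraph V} {m : ℕ}
    (h : LongPeriods G.Adj m) {a : V} {c : G.Walk a a} (hc : c.IsCycle) : m ≤ c.length := by
  have h3 := hc.three_le_length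
  have key : ∀ i, c.getVert ((i + 1) % c.length) = c.getVert (i % c.length + 1) := by
    intro i
    have hlt := Nat.mod_lt i (show 0 < c.length by omega)
    rcases Nat.lt_or_ge (i % c.length + 1) c.length with h1 | h1
    · rw [Nat.add_mod, Nat.mod_eq_of_lt (show 1 < c.length by omega), Nat.mod_eq_of_lt h1]
    · have h2 : i % c.length + 1 = c.length := by omega
      rw [Nat.add_mod, Nat.mod_eq_of_lt (show 1 < c.length by omega), h2, Nat.mod_self]
      simp
  refine h c.length (fun i => c.getVert (i % c.length)) (by omega) ?_ ?_ ?_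
  · intro i
    simp only [key]
    exact c.adj_getVert_succ (Nat.mod_lt _ (by omega))
  · intro i
    have hlt := Nat.mod_lt i (show 0 < c.length by omega)
    show c.getVert (i % c.length) ≠ c.getVert ((i + 1 + 1) % c.length)
    rw [key]
    rcases Nat.lt_or_ge (i % c.length + 1) c.length with h1 | h1
    · rw [Nat.add_mod, Nat.mod_eq_of_lt (show 1 < c.length by omega), Nat.mod_eq_of_lt h1]
      have := hc.getVert_sub_one_ne_getVert_add_one (i := i % c.length + 1) (by omega)
      simpa using this
    · have h2 : i % c.length + 1 = c.length := by omega
      rw [Nat.add_mod, Nat.mod_eq_of_lt (show 1 < c.length by omega), h2, Nat.mod_self]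
      have := hc.getVert_sub_one_ne_getVert_add_one (i := c.length) (by omega)
      intro h5
      rw [show i % c.length = c.length - 1 by omega] at h5
      have h6 := hc.snd_ne_penultimate
      exact h6 h5.symm
  · intro i
    simp

open SimpleGraph in
/-- Girth and diameter of a bipartite graph without short cycles, of diameter at most `n`, in which
there is a path of length `n + 1`. -/
theorem egirth_eq_and_ediam_eq {V : Type*} {G : SimpleGraph V} {n : ℕ} (hn : 2 ≤ n) (c : V → Bool)
    (hc : ∀ u v, G.Adj u v → c u ≠ c v) (hG : LongPeriods G.Adj (2 * n))
    (hd : ∀ u v, ∃ p : G.Walk u v, p.length ≤ n)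
    {u v : V} {p : G.Walk u v} (hp : p.IsPath) (hpl : p.length = n + 1) :
    G.egirth = 2 * (n : ℕ∞) ∧ G.ediam = (n : ℕ∞) := by
  classical
  have short : ∀ u v, ∃ p : G.Walk u v, p.IsPath ∧ p.length ≤ n := by
    intro u v
    obtain ⟨q, hq⟩ := hd u v
    exact ⟨q.bypass, q.bypass_isPath, (q.length_bypass_le_length).trans hq⟩
  have lower : (2 * n : ℕ) ≤ G.egirth :=
    le_egirth.2 fun a w hw => by exact_mod_cast hG.le_length_of_isCycle hw
  have hgirth : G.egirth = (2 * n : ℕ) := by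
    obtain ⟨q, hq, hql⟩ := short u v
    -- Paths of length n + 1 and at most n with the same ends differ, so there is a cycle of length
    -- at most 2n + 1; bipartiteness excludes 2n + 1 itself.
    have h1 := hp.egirth_le_of_ne hq (by rintro rfl; omega)
    have hnac : ¬ G.IsAcyclic := by
      intro hac
      rw [egirth_eq_top.2 hac] at h1
      exact absurd h1 (by simp)
    obtain ⟨a, w, hw, hl⟩ := exists_egirth_eq_length.2 hnac
    rw [hl] at h1 lower ⊢
    norm_cast at h1 lower ⊢
    have hev : Even w.length :=
      ((Coloring.mk c (fun {u v} h => hc u v h)).even_length_iff_congr w).2 Iff.rfl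
    obtain ⟨m, hm⟩ := hev
    omega
  refine ⟨by rw [hgirth]; norm_cast, le_antisymm ?_ ?_⟩
  · refine ediam_le_of_edist_le fun u v => ?_
    obtain ⟨p, hp⟩ := hd u v
    exact p.edist_le.trans (by exact_mod_cast hp)
  · have hnac : ¬ G.IsAcyclic := by
      intro hac
      rw [egirth_eq_top.2 hac] at hgirth
      exact ENat.top_ne_natCast _ hgirth
    obtain ⟨a, w, hw, hl⟩ := exists_egirth_eq_length.2 hnac
    have hwl : w.length = 2 * n := by
      rw [hl] at hgirth
      exact_mod_cast hgirth
    -- Opposite vertices of a shortest cycle are at distance n: a shorter path, together with half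
    -- the cycle, would enclose a cycle of length less than 2n.
    refine le_trans ?_ (edist_le_ediam (u := a) (v := w.getVert n))
    by_contra! hlt
    obtain ⟨q, hq⟩ := hd a (w.getVert n)
    obtain ⟨r, hr⟩ := q.reachable.exists_walk_length_eq_edist
    have h1 := (r.bypass_isPath).egirth_le_of_ne (hw.isPath_take (n := n) (by omega)) (by
      intro h
      have h2 := congrArg Walk.length h
      have h3 := r.length_bypass_le_length
      rw [← hr] at hlt
      norm_cast at hlt
      rw [Walk.take_length] at h2
      omega)
    rw [hgirth, Walk.take_length] at h1
    norm_cast at h1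
    have h3 := r.length_bypass_le_length
    rw [← hr] at hlt
    norm_cast at hlt
    omega

/-! ### The space of polygons is Borel. -/

/-- The sequence of vertices of a cycle, the first vertex repeated at the end. -/
def IsCycleList {V : Type*} (E : V → V → Prop) (l : List V) : Prop :=
  l.IsChain E ∧ l.head? = l.getLast? ∧ l.tail.Nodup ∧ 4 ≤ l.length

/-- Walks form a type that depends on the graph; lists of vertices form one fixed countable type, so
quantifying over them preserves measurability. -/
theorem SimpleGraph.isCycleList_iff {V : Type*} {G : SimpleGraph V} {l : List V} :
    IsCycleList G.Adj l ↔ ∃ a, ∃ w : G.Walk a a, w.IsCycle ∧ w.support = l := by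
  constructor
  · rintro ⟨h1, h2, h3, h4⟩
    have hne : l ≠ [] := by rintro rfl; simp at h4
    have he : l.head hne = l.getLast hne := by
      rw [List.head?_eq_some_head hne, List.getLast?_eq_some_getLast hne] at h2
      simpa using h2
    refine ⟨_, (Walk.ofSupport l hne h1).copy rfl he.symm, ?_, by simp⟩
    have hl : ((Walk.ofSupport l hne h1).copy rfl he.symm).length + 1 = l.length := by
      rw [← Walk.length_support]; simp
    rw [Walk.isCycle_iff_isPath_tail_and_le_length]
    refine ⟨?_, by omega⟩
    rw [Walk.isPath_def, Walk.support_tail_of_not_nil _ (by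
      intro h
      have := Walk.length_eq_zero_iff.2 h
      omega)]
    simpa using h3
  · rintro ⟨a, w, hw, rfl⟩
    refine ⟨w.isChain_adj_support, ?_, hw.support_nodup, ?_⟩
    · rw [List.head?_eq_some_head w.support_ne_nil, List.getLast?_eq_some_getLast w.support_ne_nil]
      simp
    · have := hw.three_le_length
      simp; omega

/-- The sequence of vertices of a walk. -/
def IsWalkList {V : Type*} (E : V → V → Prop) (a b : V) (l : List V) : Prop :=
  l.IsChain E ∧ l.head? = some a ∧ l.getLast? = some b

theorem SimpleGraph.isWalkList_iff {V : Type*} {G : SimpleGraph V} {a b : V} {l : List V} :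
    IsWalkList G.Adj a b l ↔ ∃ w : G.Walk a b, w.support = l := by
  constructor
  · rintro ⟨h1, h2, h3⟩
    have hne : l ≠ [] := by rintro rfl; simp at h2
    rw [List.head?_eq_some_head hne] at h2
    rw [List.getLast?_eq_some_getLast hne] at h3
    exact ⟨(Walk.ofSupport l hne h1).copy (by simpa using h2) (by simpa using h3), by simp⟩
  · rintro ⟨w, rfl⟩
    refine ⟨w.isChain_adj_support, ?_, ?_⟩
    · rw [List.head?_eq_some_head w.support_ne_nil]; simp
    · rw [List.getLast?_eq_some_getLast w.support_ne_nil]; simp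

/-- The list of a cycle repeats its first vertex, hence `m + 1` for length `m`. -/
theorem SimpleGraph.egirth_eq_natCast_iff {V : Type*} {G : SimpleGraph V} {m : ℕ} :
    G.egirth = m ↔ (∀ l, IsCycleList G.Adj l → m + 1 ≤ l.length) ∧
      ∃ l, IsCycleList G.Adj l ∧ l.length = m + 1 := by
  simp only [isCycleList_iff]
  constructor
  · intro h
    have hnac : ¬ G.IsAcyclic := by
      intro hac
      rw [egirth_eq_top.2 hac] at h
      exact ENat.top_ne_natCast _ h
    constructor
    · rintro l ⟨a, w, hw, rfl⟩
      have := egirth_le_length hw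
      rw [h] at this
      norm_cast at this
      simpa using this
    · obtain ⟨a, w, hw, hl⟩ := exists_egirth_eq_length.2 hnac
      rw [h] at hl
      norm_cast at hl
      exact ⟨_, ⟨a, w, hw, rfl⟩, by simp [hl]⟩
  · rintro ⟨h1, l, ⟨a, w, hw, rfl⟩, hl⟩
    refine le_antisymm ?_ ?_
    · refine (egirth_le_length hw).trans ?_
      norm_cast
      simpa using hl.le
    · refine le_egirth.2 fun a w hw => ?_
      have := h1 _ ⟨a, w, hw, rfl⟩
      norm_cast
      simpa using this

theorem SimpleGraph.edist_le_natCast_iff {V : Type*} {G : SimpleGraph V} {a b : V} {m : ℕ} :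
    G.edist a b ≤ m ↔ ∃ l, IsWalkList G.Adj a b l ∧ l.length ≤ m + 1 := by
  simp only [isWalkList_iff]
  constructor
  · intro h
    obtain ⟨w, hw⟩ := exists_walk_of_edist_ne_top (ne_top_of_le_ne_top (ENat.natCast_ne_top m) h)
    rw [← hw] at h
    norm_cast at h
    exact ⟨_, ⟨w, rfl⟩, by simpa using h⟩
  · rintro ⟨_, ⟨w, rfl⟩, h⟩
    refine w.edist_le.trans ?_
    norm_cast
    simpa using h

theorem SimpleGraph.ediam_eq_natCast_succ_iff {V : Type*} {G : SimpleGraph V} {m : ℕ} :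
    G.ediam = (m + 1 : ℕ) ↔
      (∀ a b, ∃ l, IsWalkList G.Adj a b l ∧ l.length ≤ m + 1 + 1) ∧
      ¬ ∀ a b, ∃ l, IsWalkList G.Adj a b l ∧ l.length ≤ m + 1 := by
  simp only [← edist_le_natCast_iff, ← ediam_le_iff]
  rw [not_le, le_antisymm_iff]
  refine and_congr_right fun _ => ?_
  rw [Nat.cast_add, Nat.cast_one, ENat.add_one_le_iff (ENat.natCast_ne_top m)]

/-- Every quantifier on the right ranges over ℕ or `List ℕ`, which makes the set visibly Borel. The
form `n - 1 + 1` fits the criterion for the diameter, which needs a successor. -/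
theorem mem_generalisedPolygonsOnNat_iff {n : ℕ} (hn : 1 ≤ n) (S : PointLineCode) :
    S ∈ generalisedPolygonsOnNat n ↔
      (∀ a b, S.2 a b = true → S.2 b a = true) ∧
      (∀ a b, S.2 a b = true → ¬ (S.1 a = true ↔ S.1 b = true)) ∧
      ((∀ l, IsCycleList (fun a b => S.2 a b = true) l → 2 * n + 1 ≤ l.length) ∧
        ∃ l, IsCycleList (fun a b => S.2 a b = true) l ∧ l.length = 2 * n + 1) ∧
      ((∀ a b, ∃ l, IsWalkList (fun a b => S.2 a b = true) a b l ∧ l.length ≤ n - 1 + 1 + 1) ∧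
        ¬ ∀ a b, ∃ l, IsWalkList (fun a b => S.2 a b = true) a b l ∧ l.length ≤ n - 1 + 1) := by
  constructor
  · rintro ⟨G, hG, hb, hg, hd⟩
    have hE : (fun a b => S.2 a b = true) = G.Adj := by
      ext a b; exact (hG a b).symm
    rw [hE]
    simp only [← hG]
    refine ⟨fun a b h => h.symm, fun a b h => ?_, SimpleGraph.egirth_eq_natCast_iff.1 ?_,
      SimpleGraph.ediam_eq_natCast_succ_iff.1 ?_⟩
    · have := hb.mem_of_adj h
      simp at this
      rcases this with ⟨h1, h2⟩ | ⟨h1, h2⟩ <;> simp [h1, h2]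
    · rw [hg]; norm_cast
    · rw [hd, Nat.sub_add_cancel hn]
  · rintro ⟨hs, hb, hg, hd⟩
    let G : SimpleGraph ℕ :=
      { Adj := fun a b => S.2 a b = true
        symm := ⟨fun a b h => hs a b h⟩
        loopless := ⟨fun a h => hb a a h Iff.rfl⟩ }
    refine ⟨G, fun a b => Iff.rfl, ⟨disjoint_compl_right, fun a b h => ?_⟩, ?_, ?_⟩
    · have := hb a b h
      simp only [Set.mem_ofPred_eq, Set.mem_compl_iff]
      tauto
    · have := SimpleGraph.egirth_eq_natCast_iff (G := G).2 hg
      rw [this]; norm_cast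
    · have := SimpleGraph.ediam_eq_natCast_succ_iff (G := G).2 hd
      rw [this, Nat.sub_add_cancel hn]

theorem measurable_isChain {X V : Type*} [MeasurableSpace X] {E : X → V → V → Prop}
    (hE : ∀ a b, Measurable fun x => E x a b) (l : List V) :
    Measurable fun x => l.IsChain (E x) := by
  induction l with
  | nil => simp
  | cons a l ih =>
    cases l with
    | nil => simp
    | cons b l =>
      simp only [List.isChain_cons_cons]
      exact (hE a b).and ih

theorem measurableSet_generalisedPolygonsOnNat {n : ℕ} (hn : 1 ≤ n) :
    MeasurableSet (generalisedPolygonsOnNat n) := by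
  have h2 : ∀ a b, Measurable fun S : PointLineCode => S.2 a b = true := fun a b =>
    Measurable.eq_const (f := fun S : PointLineCode => S.2 a b) (by fun_prop) true
  have h1 : ∀ a, Measurable fun S : PointLineCode => S.1 a = true := fun a =>
    Measurable.eq_const (f := fun S : PointLineCode => S.1 a) (by fun_prop) true
  have hc : ∀ l : List ℕ, Measurable fun S : PointLineCode =>
      l.IsChain (fun a b => S.2 a b = true) := measurable_isChain h2
  have : generalisedPolygonsOnNat n = {S | S ∈ generalisedPolygonsOnNat n} := rfl
  rw [this]
  simp only [mem_generalisedPolygonsOnNat_iff hn, IsCycleList, IsWalkList]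
  rw [measurableSet_setOfPred]
  fun_prop

/-! ### Reduction of polygons to graphs. -/

/-- The graph obtained from a point-line structure by adding a triangle `0, 1, 2`, whose vertex `0`
is joined to all points; the element `a` becomes the vertex `a + 3`. -/
def triangleCode (S : PointLineCode) : RelCode := fun i j =>
  if i < 3 ∧ j < 3 then decide (i ≠ j)
  else if i < 3 then decide (i = 0) && S.1 (j - 3)
  else if j < 3 then decide (j = 0) && S.1 (i - 3)
  else S.2 (i - 3) (j - 3)

theorem triangleCode_add_add (S : PointLineCode) (a b : ℕ) :
    triangleCode S (a + 3) (b + 3) = S.2 a b := by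
  simp [triangleCode]

theorem measurable_triangleCode : Measurable triangleCode := by
  refine measurable_pi_lambda _ fun i => measurable_pi_lambda _ fun j => ?_
  unfold triangleCode
  split_ifs <;> fun_prop

/-- A bipartite graph has no triangles, and the neighbours of `0` among its vertices are points, no
two of them incident. So the added triangle is the only one and every isomorphism respects it. -/
theorem exists_triangle_triangleCode_iff {S : PointLineCode}
    (hb : ∀ a b, S.2 a b = true → ¬ (S.1 a = true ↔ S.1 b = true)) (i : ℕ) :
    (∃ j k, triangleCode S i j = true ∧ triangleCode S j k = true ∧ triangleCode S i k = true) ↔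
      i < 3 := by
  constructor
  · rintro ⟨j, k, h1, h2, h3⟩
    by_contra! hi
    obtain ⟨a, rfl⟩ := Nat.exists_eq_add_of_le' hi
    rcases Nat.lt_or_ge j 3 with hj | hj
    · rcases Nat.lt_or_ge k 3 with hk | hk
      · simp [triangleCode, hj, hk] at h1 h2 h3
        omega
      · obtain ⟨c, rfl⟩ := Nat.exists_eq_add_of_le' hk
        rw [triangleCode_add_add] at h3
        have := hb _ _ h3
        simp [triangleCode, hj] at h1 h2
        simp [h1, h2] at this
    · obtain ⟨b, rfl⟩ := Nat.exists_eq_add_of_le' hj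
      rw [triangleCode_add_add] at h1
      have h1' := hb _ _ h1
      rcases Nat.lt_or_ge k 3 with hk | hk
      · simp [triangleCode, hk] at h2 h3
        simp [h2, h3] at h1'
      · obtain ⟨c, rfl⟩ := Nat.exists_eq_add_of_le' hk
        rw [triangleCode_add_add] at h2 h3
        have h2' := hb _ _ h2
        have h3' := hb _ _ h3
        tauto
  · intro hi
    have : i = 0 ∨ i = 1 ∨ i = 2 := by omega
    rcases this with rfl | rfl | rfl
    · exact ⟨1, 2, by simp [triangleCode]⟩
    · exact ⟨0, 2, by simp [triangleCode]⟩
    · exact ⟨0, 1, by simp [triangleCode]⟩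

/-- This recovers the sorts: the points are the vertices joined to the triangle. -/
theorem exists_lt_three_triangleCode_iff (S : PointLineCode) (a : ℕ) :
    (∃ i < 3, triangleCode S i (a + 3) = true) ↔ S.1 a = true := by
  constructor
  · rintro ⟨i, hi, h⟩
    simp [triangleCode, hi] at h
    exact h.2
  · intro h
    exact ⟨0, by norm_num, by simp [triangleCode, h]⟩

theorem triangleCode_iso {S T : PointLineCode} (h : S.Iso T) :
    (triangleCode S).Iso (triangleCode T) := by
  obtain ⟨σ, h1, h2⟩ := h
  refine ⟨⟨fun i => if i < 3 then i else σ (i - 3) + 3,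
    fun i => if i < 3 then i else σ.symm (i - 3) + 3, fun i => ?_, fun i => ?_⟩, fun i j => ?_⟩
  · by_cases hi : i < 3
    · simp [hi]
    · simp [hi]; omega
  · by_cases hi : i < 3
    · simp [hi]
    · simp [hi]; omega
  · by_cases hi : i < 3 <;> by_cases hj : j < 3 <;> simp [hi, hj, triangleCode, h1, h2]

theorem iso_of_triangleCode_iso {S T : PointLineCode}
    (hS : ∀ a b, S.2 a b = true → ¬ (S.1 a = true ↔ S.1 b = true))
    (hT : ∀ a b, T.2 a b = true → ¬ (T.1 a = true ↔ T.1 b = true))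
    (h : (triangleCode S).Iso (triangleCode T)) : S.Iso T := by
  obtain ⟨τ, h⟩ := h
  have hlt : ∀ i, τ i < 3 ↔ i < 3 := by
    intro i
    rw [← exists_triangle_triangleCode_iff hT (τ i), ← exists_triangle_triangleCode_iff hS i,
      τ.surjective.exists]
    refine exists_congr fun j => ?_
    rw [τ.surjective.exists]
    simp only [h]
  have hlt' : ∀ i, τ.symm i < 3 ↔ i < 3 := fun i => by
    rw [← hlt, Equiv.apply_symm_apply]
  -- The subtraction is not truncated, because `τ` preserves the complement of the triangle.
  have e1 : ∀ a, τ (a + 3) - 3 + 3 = τ (a + 3) := fun a => by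
    have := hlt (a + 3); omega
  have e2 : ∀ a, τ.symm (a + 3) - 3 + 3 = τ.symm (a + 3) := fun a => by
    have := hlt' (a + 3); omega
  refine ⟨⟨fun a => τ (a + 3) - 3, fun a => τ.symm (a + 3) - 3, fun a => ?_, fun a => ?_⟩,
    fun a => ?_, fun a b => ?_⟩
  · simp [e1]
  · simp [e2]
  · rw [Bool.eq_iff_iff, ← exists_lt_three_triangleCode_iff, ← exists_lt_three_triangleCode_iff]
    simp only [Equiv.coe_fn_mk, e1]
    constructor
    · rintro ⟨i, hi, h1⟩
      exact ⟨τ i, (hlt i).2 hi, by rwa [← h]⟩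
    · rintro ⟨i, hi, h1⟩
      exact ⟨τ.symm i, (hlt' i).2 hi, by rwa [h, Equiv.apply_symm_apply]⟩
  · simp only [Equiv.coe_fn_mk]
    rw [← triangleCode_add_add T, e1, e1, ← h, triangleCode_add_add]

theorem generalisedPolygons_reducible_graphs {n : ℕ} (hn : 1 ≤ n) :
    BorelReducible
      (fun S T : generalisedPolygonsOnNat n => PointLineCode.Iso S.1 T.1)
      (fun E F : graphsOnNat => RelCode.Iso E.1 F.1) := by
  have hb : ∀ S : generalisedPolygonsOnNat n,
      ∀ a b, S.1.2 a b = true → ¬ (S.1.1 a = true ↔ S.1.1 b = true) := fun S =>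
    ((mem_generalisedPolygonsOnNat_iff hn S.1).1 S.2).2.1
  have hs : ∀ S : generalisedPolygonsOnNat n, ∀ a b, S.1.2 a b = S.1.2 b a := fun S a b => by
    have := ((mem_generalisedPolygonsOnNat_iff hn S.1).1 S.2).1
    exact Bool.eq_iff_iff.2 ⟨this a b, this b a⟩
  refine ⟨fun S => ⟨triangleCode S.1, fun i => ?_, fun i j => ?_⟩,
    (measurable_triangleCode.comp measurable_subtype_coe).subtype_mk, fun S T =>
      ⟨triangleCode_iso, iso_of_triangleCode_iso (hb S) (hb T)⟩⟩
  · by_cases hi : i < 3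
    · simp [triangleCode, hi]
    · by_contra! h
      simp [triangleCode, hi] at h
      exact hb S _ _ h Iff.rfl
  · by_cases hi : i < 3 <;> by_cases hj : j < 3 <;> simp [hi, hj, triangleCode, eq_comm, hs S]

/-! ### Finite cubic bipartite graphs of large girth. -/

/-- Words of length at most `r` in three letters, without repeated consecutive letters. -/
def ReducedWord (r : ℕ) : Type := {l : List (Fin 3) // l.IsChain (· ≠ ·) ∧ l.length ≤ r}

instance (r : ℕ) : Finite (ReducedWord r) :=
  ((List.finite_length_le (Fin 3) r).subset fun _ h => h.2 : Set.Finite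
    {l : List (Fin 3) | l.IsChain (· ≠ ·) ∧ l.length ≤ r}).to_subtype

namespace ReducedWord

/-- The empty word. -/
def nil (r : ℕ) : ReducedWord r := ⟨[], by simp⟩

/-- Multiplication of a word by a letter on the left, in the free product of three groups of order
two, as far as the bound on the length permits. -/
def toggle {r : ℕ} (i : Fin 3) (l : ReducedWord r) : ReducedWord r :=
  if h : l.1.head? = some i then
    ⟨l.1.tail, l.2.1.tail, by have := l.2.2; simp; omega⟩
  else if h' : l.1.length < r then
    ⟨i :: l.1, List.isChain_cons.2 ⟨fun y hy hi => h (by rw [hi]; exact hy), l.2.1⟩, h'⟩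
  else l

theorem toggle_of_ne {r : ℕ} {i : Fin 3} {l : ReducedWord r} (h : l.1.head? ≠ some i)
    (h' : l.1.length < r) : (toggle i l).1 = i :: l.1 := by
  simp [toggle, h, h']

/-- A word of maximal length that does not begin with `i` is fixed; any other word gains or loses
the initial `i`. -/
theorem toggle_toggle {r : ℕ} (i : Fin 3) (l : ReducedWord r) : toggle i (toggle i l) = l := by
  obtain ⟨l, h1, h2⟩ := l
  cases l with
  | nil =>
    by_cases hr : 0 < r
    · simp [toggle, hr]; rfl
    · simp [toggle, hr]; rfl
  | cons a t =>
    by_cases ha : a = i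
    · subst ha
      have h3 : t.head? ≠ some a := by
        intro h
        exact (List.isChain_cons.1 h1).1 a h rfl
      have h4 : t.length < r := h2
      simp [toggle, h3, h4]; rfl
    · by_cases hr : t.length + 1 < r
      · simp [toggle, ha, hr]; rfl
      · simp [toggle, ha, hr]; rfl

/-- `toggle` as a permutation. -/
def gen (r : ℕ) (i : Fin 3) : Equiv.Perm (ReducedWord r) :=
  ⟨toggle i, toggle i, toggle_toggle i, toggle_toggle i⟩

theorem gen_mul_gen (r : ℕ) (i : Fin 3) : gen r i * gen r i = 1 := by
  ext1 l
  exact toggle_toggle i l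

theorem gen_injective {r : ℕ} (hr : 0 < r) : Function.Injective (gen r) := by
  intro i j h
  have h1 := congrArg (fun f : Equiv.Perm (ReducedWord r) => (f (nil r)).1) h
  change (toggle i (nil r)).1 = (toggle j (nil r)).1 at h1
  rw [toggle_of_ne (by simp [nil]) hr, toggle_of_ne (by simp [nil]) hr] at h1
  simpa using h1

end ReducedWord

/-- The vertices of a finite cubic bipartite graph of girth more than `r`. -/
abbrev Cage (r : ℕ) : Type := Equiv.Perm (ReducedWord r) × Bool

namespace Cage

open ReducedWord

/-- The bipartite double of the Cayley graph of the permutations `ReducedWord.gen r i`. -/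
def Adj {r : ℕ} (x y : Cage r) : Prop := x.2 ≠ y.2 ∧ ∃ i, y.1 = x.1 * gen r i

theorem Adj.symm {r : ℕ} {x y : Cage r} (h : x.Adj y) : y.Adj x := by
  obtain ⟨h, i, hi⟩ := h
  exact ⟨h.symm, i, by rw [hi, mul_assoc, gen_mul_gen, mul_one]⟩

theorem three_le_ncard_adj {r : ℕ} (hr : 0 < r) (x : Cage r) : 3 ≤ {y | x.Adj y}.ncard := by
  have h1 : Function.Injective fun i : Fin 3 => ((x.1 * gen r i, !x.2) : Cage r) := by
    intro i j h
    simp only [Prod.mk.injEq, mul_right_inj, and_true] at h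
    exact gen_injective hr h
  have h2 : Set.range (fun i : Fin 3 => ((x.1 * gen r i, !x.2) : Cage r)) ⊆ {y | x.Adj y} := by
    rintro _ ⟨i, rfl⟩
    exact ⟨by simp, i, rfl⟩
  calc 3 = (Set.range fun i : Fin 3 => ((x.1 * gen r i, !x.2) : Cage r)).ncard := by
        rw [← Set.image_univ, Set.ncard_image_of_injective _ h1]
        simp
    _ ≤ _ := Set.ncard_le_ncard h2 (Set.toFinite _)

/-- The letters of the steps of the walk form a word, which is reduced because the walk does not
backtrack. Applied to the empty word, their product spells that word out, since the bound `r` is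
never exceeded. The last clause carries the first letter through the induction. -/
theorem exists_word_of_walk {r : ℕ} : ∀ (k : ℕ) (w : ℕ → Cage r), k ≤ r →
    (∀ i < k, (w i).Adj (w (i + 1))) → (∀ i, i + 1 < k → w i ≠ w (i + 2)) →
    ∃ l : ReducedWord r, (w k).1 (nil r) = (w 0).1 l ∧ l.1.length = k ∧
      ∀ i, l.1.head? = some i → (w 1).1 = (w 0).1 * gen r i
  | 0, w, _, _, _ => ⟨nil r, rfl, rfl, by simp [nil]⟩
  | k + 1, w, hk, hw, hb => by
    obtain ⟨l, h1, h2, h3⟩ := exists_word_of_walk k (fun i => w (i + 1)) (by omega)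
      (fun i hi => hw (i + 1) (by omega)) (fun i hi => hb (i + 1) (by omega))
    obtain ⟨hs, i, hi⟩ := hw 0 (by omega)
    have hhead : l.1.head? ≠ some i := by
      intro h
      have hk0 : 0 < k := by
        rw [← h2]
        refine List.length_pos_iff.2 ?_
        rintro h0
        simp [h0] at h
      have h4 := h3 i h
      -- Two equal letters in a row cancel and the colour flips twice, so the walk would backtrack.
      refine hb 0 (by omega) (Prod.ext ?_ ?_)
      · simp only [zero_add] at h4 hi
        rw [h4, hi, mul_assoc, gen_mul_gen, mul_one]
      · have h5 := (hw 1 (by omega)).1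
        simp only [zero_add] at hs
        revert hs h5
        change (w 1).2 ≠ (w 2).2 → (w 0).2 ≠ (w 1).2 → (w 0).2 = (w 2).2
        cases (w 0).2 <;> cases (w 1).2 <;> cases (w 2).2 <;> simp
    have h6 := toggle_of_ne hhead (by omega : l.1.length < r)
    refine ⟨toggle i l, ?_, by simp [h6, h2], fun j hj => ?_⟩
    · rw [h1]
      simp only [zero_add] at hi ⊢
      rw [hi]
      rfl
    · rw [h6] at hj
      simp only [List.head?_cons, Option.some.injEq] at hj
      rw [← hj]
      exact hi

/-- A closed walk without backtracking has length more than `r`. -/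
theorem lt_of_closed_walk {r k : ℕ} {w : ℕ → Cage r} (hk : 0 < k)
    (hw : ∀ i < k, (w i).Adj (w (i + 1))) (hb : ∀ i, i + 1 < k → w i ≠ w (i + 2))
    (hc : w k = w 0) : r < k := by
  by_contra! hr
  obtain ⟨l, h1, h2, -⟩ := exists_word_of_walk k w hr hw hb
  rw [hc] at h1
  -- For a closed walk the same permutation sends `l` and the empty word to one place, so `l` is
  -- empty.
  rw [← (w 0).1.injective h1] at h2
  simp [nil] at h2
  omega

end Cage

/-! ### Coding a relation by long paths. -/

/-- The vertices of a graph coded by long paths: `pt a` is the vertex `a`, and `mid a b i` runs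
through the interior of the path from `a` to `b`. -/
inductive Junction (n : ℕ) : Type
  | pt (a : ℕ) : Junction n
  | mid (a b : ℕ) (i : Fin (2 * n + 1)) : Junction n

namespace Junction

variable {n : ℕ}

instance : Countable (Junction n) := by
  have : Function.Injective (fun x : Junction n => match x with
      | pt a => (Sum.inl a : ℕ ⊕ ℕ × ℕ × Fin (2 * n + 1))
      | mid a b i => Sum.inr (a, b, i)) := by
    intro x y h
    cases x <;> cases y <;> simp_all
  exact this.countable

/-- The steps in the direction of the paths. The first step of the path from `a` to `b` is there
only if `a` and `b` are related. -/
def Up (R : ℕ → ℕ → Prop) : Junction n → Junction n → Prop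
  | pt a, mid a' b i => a' = a ∧ i.val = 0 ∧ R a b
  | mid a b i, mid a' b' j => a' = a ∧ b' = b ∧ j.val = i.val + 1
  | mid _ b i, pt b' => b' = b ∧ i.val = 2 * n
  | pt _, pt _ => False

/-- Adjacency in the graph of paths. -/
def Adj (R : ℕ → ℕ → Prop) (u v : Junction n) : Prop := Up R u v ∨ Up R v u

/-- The position in the path. -/
def height : Junction n → ℕ
  | pt _ => 0
  | mid _ _ i => i.val + 1

/-- A proper colouring of the graph of paths. -/
def color : Junction n → Bool
  | pt _ => false
  | mid _ _ i => decide (i.val % 2 = 0)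

variable {R : ℕ → ℕ → Prop}

/-- With `Up.eq_of_left`, this prevents a walk without backtracking from turning round inside a
path. -/
theorem Up.eq_of_right {u u' v : Junction n} (h : Up R u v) (h' : Up R u' v)
    (hv : v.height ≠ 0) : u = u' := by
  cases u <;> cases u' <;> cases v <;> simp_all [Up, height]
  omega

theorem Up.eq_of_left {u v v' : Junction n} (h : Up R u v) (h' : Up R u v')
    (hu : u.height ≠ 0) : v = v' := by
  cases u with
  | pt a => simp [height] at hu
  | mid a b i =>
    cases v with
    | pt c =>
      cases v' with
      | pt d => simp_all [Up]
      | mid c' d' j =>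
        have h1 := h.2
        have h2 := h'.2.2
        have := j.2
        omega
    | mid c d j =>
      cases v' with
      | pt c' =>
        have h1 := h.2.2
        have h2 := h'.2
        have := j.2
        omega
      | mid c' d' j' =>
        simp_all [Up, Fin.ext_iff]

theorem Up.height_right {u v : Junction n} (h : Up R u v) :
    v.height = u.height + 1 ∨ v.height = 0 ∧ u.height = 2 * n + 1 := by
  cases u <;> cases v <;> simp_all [Up, height]

/-- The number 2n + 1 of interior vertices is odd, so the last one has the colour opposite to that
of `pt`, like the first. -/
theorem Up.color_ne {u v : Junction n} (h : Up R u v) : u.color ≠ v.color := by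
  cases u <;> cases v <;> simp_all [Up, color]
  omega

theorem Adj.color_ne {u v : Junction n} (h : Adj R u v) : u.color ≠ v.color :=
  h.elim Up.color_ne fun h => h.color_ne.symm

theorem Adj.symm {u v : Junction n} (h : Adj R u v) : Adj R v u := Or.symm h

/-- Inside a path the height along the walk is strictly monotone. A walk that meets some `pt` must
therefore cover a whole path, of length 2n + 2, before the height is `0` again; a walk that meets
none cannot be periodic. -/
theorem longPeriods_adj (n : ℕ) (R : ℕ → ℕ → Prop) :
    LongPeriods (Adj R : Junction n → Junction n → Prop) (2 * n) := by
  intro k w hk hw hb hp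
  by_contra! hlt
  have up_next : ∀ t, Up R (w t) (w (t + 1)) → (w (t + 1)).height ≠ 0 →
      Up R (w (t + 1)) (w (t + 2)) := fun t h h0 =>
    (hw (t + 1)).elim id fun h' => absurd (h.eq_of_right h' h0) (hb t)
  have down_next : ∀ t, Up R (w (t + 1)) (w t) → (w (t + 1)).height ≠ 0 →
      Up R (w (t + 2)) (w (t + 1)) := fun t h h0 =>
    (hw (t + 1)).elim (fun h' => absurd (h.eq_of_left h' h0) (hb t)) id
  by_cases hz : ∃ t, (w t).height = 0
  · obtain ⟨t, ht⟩ := hz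
    have hkt := congrArg height (hp t)
    rcases hw t with h | h
    · have : ∀ j, j ≤ 2 * n → (w (t + j)).height = j ∧ Up R (w (t + j)) (w (t + j + 1)) := by
        intro j
        induction j with
        | zero => exact fun _ => ⟨ht, h⟩
        | succ j ih =>
          intro hj
          obtain ⟨h1, h2⟩ := ih (by omega)
          have h3 := h2.height_right
          have h4 : (w (t + j + 1)).height = j + 1 := by omega
          exact ⟨h4, up_next (t + j) h2 (by omega)⟩
      have := (this k (by omega)).1
      omega
    · have : ∀ j, j ≤ 2 * n → (w (t + j + 1)).height = 2 * n + 1 - j ∧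
          Up R (w (t + j + 1)) (w (t + j)) := by
        intro j
        induction j with
        | zero =>
          have := h.height_right
          exact fun _ => ⟨by simp only [add_zero]; omega, h⟩
        | succ j ih =>
          intro hj
          obtain ⟨h1, h2⟩ := ih (by omega)
          have h5 := down_next (t + j) h2 (by omega)
          have h3 := h5.height_right
          exact ⟨by rw [show t + (j + 1) + 1 = t + j + 2 by ring]; omega, h5⟩
      have := (this (k - 1) (by omega)).1
      rw [show t + (k - 1) + 1 = t + k by omega] at this
      omega
  · push Not at hz
    have hk0 := congrArg height (hp 0)
    rw [zero_add] at hk0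
    rcases hw 0 with h | h
    · have : ∀ j, (w j).height = (w 0).height + j ∧ Up R (w j) (w (j + 1)) := by
        intro j
        induction j with
        | zero => exact ⟨rfl, h⟩
        | succ j ih =>
          obtain ⟨h1, h2⟩ := ih
          have h3 := h2.height_right
          have := hz (j + 1)
          exact ⟨by omega, up_next _ h2 this⟩
      have := (this k).1
      omega
    · have : ∀ j, (w j).height + j = (w 0).height ∧ Up R (w (j + 1)) (w j) := by
        intro j
        induction j with
        | zero => exact ⟨rfl, h⟩
        | succ j ih =>
          obtain ⟨h1, h2⟩ := ih
          have h3 := h2.height_right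
          have := hz j
          exact ⟨by omega, down_next _ h2 (hz _)⟩
      have := (this k).1
      omega

/-- The action of permutations on the paths. -/
def perm (σ : Equiv.Perm ℕ) : Equiv.Perm (Junction n) where
  toFun
    | pt a => pt (σ a)
    | mid a b i => mid (σ a) (σ b) i
  invFun
    | pt a => pt (σ.symm a)
    | mid a b i => mid (σ.symm a) (σ.symm b) i
  left_inv x := by cases x <;> simp
  right_inv x := by cases x <;> simp

theorem up_perm {R' : ℕ → ℕ → Prop} {σ : Equiv.Perm ℕ} (h : ∀ a b, R a b ↔ R' (σ a) (σ b))
    (u v : Junction n) : Up R u v ↔ Up R' (perm σ u) (perm σ v) := by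
  cases u <;> cases v <;> simp [Up, perm, h]

theorem adj_perm {R' : ℕ → ℕ → Prop} {σ : Equiv.Perm ℕ} (h : ∀ a b, R a b ↔ R' (σ a) (σ b))
    (u v : Junction n) : Adj R u v ↔ Adj R' (perm σ u) (perm σ v) :=
  or_congr (up_perm h u v) (up_perm h v u)

theorem color_perm (σ : Equiv.Perm ℕ) (u : Junction n) : (perm σ u).color = u.color := by
  cases u <;> rfl

theorem measurable_adj (u v : Junction n) {X : Type*} [MeasurableSpace X] {R : X → ℕ → ℕ → Prop}
    (hR : ∀ a b, Measurable fun x => R x a b) : Measurable fun x => Adj (R x) u v := by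
  have up : ∀ u v : Junction n, Measurable fun x => Up (R x) u v := by
    intro u v
    cases u <;> cases v <;> simp only [Up] <;> fun_prop
  exact (up u v).or (up v u)

end Junction

/-! ### Attaching cages, and recovering the relation. -/

/-- The finite subgraph generated by a vertex of minimal degree at least three. -/
def InCore {V : Type*} (E : V → V → Prop) (x : V) : Prop :=
  ∃ S : Set V, S.Finite ∧ x ∈ S ∧ ∀ u ∈ S, 3 ≤ {v | v ∈ S ∧ E u v}.ncard

/-- There is a walk from `x` to `y` whose interior vertices have finite degree. -/
def Linked {V : Type*} (E : V → V → Prop) (x y : V) : Prop :=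
  ∃ u v, E x u ∧ E v y ∧ {z | E u z}.Finite ∧
    Relation.ReflTransGen (fun p q => E p q ∧ {z | E q z}.Finite) u v

theorem infinite_adj_iff {V W : Type*} {E : V → V → Prop} {F : W → W → Prop} (e : V ≃ W)
    (h : ∀ x y, E x y ↔ F (e x) (e y)) (x : V) :
    {y | F (e x) y}.Infinite ↔ {y | E x y}.Infinite := by
  have : {y | F (e x) y} = e '' {y | E x y} := by
    ext y
    obtain ⟨z, rfl⟩ := e.surjective y
    simp [h]
  rw [this, Set.infinite_image_iff e.injective.injOn]

theorem Linked.map {V W : Type*} {E : V → V → Prop} {F : W → W → Prop} (e : V ≃ W)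
    (h : ∀ x y, E x y ↔ F (e x) (e y)) {x y : V} (hl : Linked E x y) : Linked F (e x) (e y) := by
  have hf : ∀ z, {y | F (e z) y}.Finite ↔ {y | E z y}.Finite := fun z => by
    have := infinite_adj_iff e h z
    rw [← not_iff_not]
    exact this
  obtain ⟨u, v, h1, h2, h3, h4⟩ := hl
  refine ⟨e u, e v, (h _ _).1 h1, (h _ _).1 h2, (hf u).2 h3, ?_⟩
  exact h4.lift e fun a b hab => ⟨(h _ _).1 hab.1, (hf b).2 hab.2⟩

/-- The vertices of the graph obtained from a graph of paths by attaching a cage at each vertex. -/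
abbrev Base (n : ℕ) : Type := Junction n × Cage (2 * n)

namespace Base

variable {n : ℕ}

/-- The vertex of the cage that is identified with a vertex of the graph of paths. -/
def root (n : ℕ) : Cage (2 * n) := (1, false)

/-- Adjacency inside a cage. -/
def Inner (x y : Base n) : Prop := x.1 = y.1 ∧ x.2.Adj y.2

/-- Adjacency in the graph of paths. -/
def Cross (R : ℕ → ℕ → Prop) (x y : Base n) : Prop :=
  x.1.Adj R y.1 ∧ x.2 = root n ∧ y.2 = root n

/-- Adjacency in the rooted product of the graph of paths and the cage. -/
def Adj (R : ℕ → ℕ → Prop) (x y : Base n) : Prop := Inner x y ∨ Cross R x y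

/-- A proper colouring. -/
def color (x : Base n) : Bool := xor x.1.color x.2.2

variable {R : ℕ → ℕ → Prop}

theorem Adj.symm {x y : Base n} (h : Adj R x y) : Adj R y x :=
  h.imp (fun h => ⟨h.1.symm, h.2.symm⟩) fun h => ⟨h.1.symm, h.2.2, h.2.1⟩

theorem Adj.color_ne {x y : Base n} (h : Adj R x y) : color x ≠ color y := by
  rcases h with ⟨h1, h2, -⟩ | ⟨h1, h2, h3⟩
  · simp only [color, h1]
    simpa using h2
  · simp only [color, h2, h3]
    simpa using h1.color_ne

/-- Each cage meets the rest of the graph in its root only. An excursion into a cage is thus a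
closed walk there, which is too long; so the whole walk stays either in one cage or in the graph of
paths. -/
theorem longPeriods_adj (n : ℕ) (R : ℕ → ℕ → Prop) :
    LongPeriods (Adj R : Base n → Base n → Prop) (2 * n) := by
  intro k w hk hw hb hp
  by_contra! hlt
  by_cases hc : ∃ t, Cross R (w t) (w (t + 1))
  · obtain ⟨t, ht⟩ := hc
    have all : ∀ j, Cross R (w (t + j)) (w (t + j + 1)) := by
      intro j
      induction j with
      | zero => exact ht
      | succ j ih =>
        by_contra hn
        -- By periodicity the walk returns to a step outside the cages; the first such return ends
        -- the excursion.
        have hex : ∃ m, Cross R (w (t + j + m + 1)) (w (t + j + m + 2)) := by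
          refine ⟨k - 1, ?_⟩
          have h1 := hp (t + j)
          have h2 := hp (t + j + 1)
          rw [show t + j + (k - 1) + 1 = t + j + k by omega,
            show t + j + (k - 1) + 2 = t + j + 1 + k by omega, h1, h2]
          exact ih
        classical
        have hm := Nat.find_spec hex
        have hmin : ∀ m < Nat.find hex, ¬ Cross R _ _ := fun m hm => Nat.find_min hex hm
        have hle : Nat.find hex ≤ k - 1 := by
          refine Nat.find_min' hex ?_
          have h1 := hp (t + j)
          have h2 := hp (t + j + 1)
          rw [show t + j + (k - 1) + 1 = t + j + k by omega,
            show t + j + (k - 1) + 2 = t + j + 1 + k by omega, h1, h2]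
          exact ih
        set m := Nat.find hex
        have hpos : 0 < m := by
          rcases Nat.eq_zero_or_pos m with h0 | h0
          · rw [h0] at hm
            exact absurd hm hn
          · exact h0
        have hin : ∀ i < m, Inner (w (t + j + i + 1)) (w (t + j + i + 2)) := fun i hi =>
          (hw (t + j + i + 1)).resolve_right (hmin i hi)
        have := Cage.lt_of_closed_walk (w := fun i => (w (t + j + i + 1)).2) hpos
          (fun i hi => (hin i hi).2) (fun i hi h => hb (t + j + i + 1) (Prod.ext
            ((hin i (by omega)).1.trans (hin (i + 1) hi).1) h)) (hm.2.1.trans ih.2.2.symm)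
        omega
    have := Junction.longPeriods_adj n R k (fun j => (w (t + j)).1) hk (fun j => (all j).1)
      (fun j h => hb (t + j) (Prod.ext h ((all j).2.1.trans (all (j + 1)).2.2.symm)))
      (fun j => by
        have := hp (t + j)
        rw [add_assoc] at this
        rw [this])
    omega
  · push Not at hc
    have hin : ∀ i, Inner (w i) (w (i + 1)) := fun i => (hw i).resolve_right (hc i)
    have := Cage.lt_of_closed_walk (w := fun i => (w i).2) hk (fun i _ => (hin i).2)
      (fun i _ h => hb i (Prod.ext ((hin i).1.trans (hin (i + 1)).1) h))
      (by have := hp 0; rw [zero_add] at this; rw [this])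
    omega

theorem inCore (hn : 0 < n) (x : Base n) : InCore (Adj R) x := by
  refine ⟨{y | y.1 = x.1}, ?_, rfl, ?_⟩
  · refine (Set.toFinite (Set.range fun g : Cage (2 * n) => (x.1, g))).subset ?_
    rintro ⟨h, g⟩ rfl
    exact ⟨g, rfl⟩
  · intro u hu
    have h1 := Cage.three_le_ncard_adj (r := 2 * n) (by omega) u.2
    refine h1.trans ?_
    rw [← Set.ncard_image_of_injective _ (Prod.mk_right_injective x.1)]
    refine Set.ncard_le_ncard ?_ ?_
    · rintro _ ⟨g, hg, rfl⟩
      exact ⟨rfl, Or.inl ⟨hu, hg⟩⟩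
    · refine (Set.toFinite (Set.range fun g : Cage (2 * n) => (x.1, g))).subset ?_
      rintro ⟨h, g⟩ ⟨rfl, -⟩
      exact ⟨g, rfl⟩

/-- The last steps of the chains from all `a` to `b` give `pt b` infinite degree whatever `R` is;
every other vertex sees only finitely many chain vertices and its own finite cage. -/
theorem infinite_adj_iff (x : Base n) :
    {y | Adj R x y}.Infinite ↔ ∃ a, x = (.pt a, root n) := by
  have hfin : ∀ h : Junction n, (Set.range fun g : Cage (2 * n) => (h, g)).Finite := fun h =>
    Set.toFinite _
  constructor
  · obtain ⟨h, g⟩ := x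
    intro hinf
    by_contra! hx
    apply hinf
    cases h with
    | pt a =>
      refine (hfin (.pt a)).subset ?_
      rintro ⟨h', g'⟩ (⟨h1, h2⟩ | ⟨h1, h2, h3⟩)
      · exact ⟨g', Prod.ext h1 rfl⟩
      · exact absurd (show ((.pt a, g) : Base n) = (.pt a, root n) from Prod.ext rfl h2) (hx a)
    | mid a b i =>
      refine ((hfin (.mid a b i)).union ((hfin (.pt a)).union ((hfin (.pt b)).union
        (Set.finite_range fun j => ((.mid a b j, root n) : Base n))))).subset ?_
      rintro ⟨h', g'⟩ (⟨h1, h2⟩ | ⟨h1, h2, h3⟩)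
      · exact Or.inl ⟨g', Prod.ext h1 rfl⟩
      · right
        simp only at h3
        subst h3
        cases h' with
        | pt c =>
          rcases h1 with h1 | h1
          · exact Or.inr (Or.inl ⟨root n, by rw [h1.1]⟩)
          · exact Or.inl ⟨root n, by rw [h1.1]⟩
        | mid c d j =>
          right; right
          refine ⟨j, ?_⟩
          rcases h1 with h1 | h1
          · rw [h1.1, h1.2.1]
          · rw [← h1.1, ← h1.2.1]
  · rintro ⟨b, rfl⟩
    refine Set.infinite_of_injective_forall_mem
      (f := fun a : ℕ => ((.mid a b (Fin.last (2 * n)), root n) : Base n)) ?_ ?_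
    · intro a a' h
      simpa using h
    · intro a
      exact Or.inr ⟨Or.inr ⟨rfl, rfl⟩, rfl, rfl⟩

theorem finite_adj_mid (a b : ℕ) (i : Fin (2 * n + 1)) (g : Cage (2 * n)) :
    {y | Adj R (.mid a b i, g) y}.Finite := by
  by_contra h
  obtain ⟨c, hc⟩ := (infinite_adj_iff _).1 h
  simp at hc

theorem linked_of_rel {a b : ℕ} (h : R a b) :
    Linked (Adj R : Base n → Base n → Prop) (.pt a, root n) (.pt b, root n) := by
  refine ⟨(.mid a b 0, root n), (.mid a b (Fin.last (2 * n)), root n),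
    Or.inr ⟨Or.inl ⟨rfl, rfl, h⟩, rfl, rfl⟩, Or.inr ⟨Or.inl ⟨rfl, rfl⟩, rfl, rfl⟩,
    finite_adj_mid _ _ _ _, ?_⟩
  have : ∀ i (hi : i < 2 * n + 1), Relation.ReflTransGen
      (fun p q : Base n => Adj R p q ∧ {z | Adj R q z}.Finite)
      (.mid a b 0, root n) (.mid a b ⟨i, hi⟩, root n) := by
    intro i
    induction i with
    | zero => exact fun _ => .refl
    | succ i ih =>
      intro hi
      exact (ih (by omega)).tail ⟨Or.inr ⟨Or.inl ⟨rfl, rfl, rfl⟩, rfl, rfl⟩, finite_adj_mid _ _ _ _⟩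
  exact this _ _

theorem rel_of_linked {a b : ℕ} (hab : a ≠ b)
    (h : Linked (Adj R : Base n → Base n → Prop) (.pt b, root n) (.pt a, root n)) :
    R a b ∨ R b a := by
  obtain ⟨u, v, hu, hv, hf, huv⟩ := h
  -- `S` bounds what can be reached from `pt b` without passing another `pt`: chains ending at `b`,
  -- chains from `b` to a related vertex, and the cages on them and on `pt b`.
  let S : Base n → Prop := fun x => match x.1 with
    | .pt c => c = b
    | .mid c d _ => d = b ∨ c = b ∧ R c d
  have hbig : ∀ c, ¬ {z : Base n | Adj R (.pt c, root n) z}.Finite := fun c =>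
    (infinite_adj_iff _).2 ⟨c, rfl⟩
  have step : ∀ x y : Base n, S x → Adj R x y → {z | Adj R y z}.Finite → S y := by
    rintro ⟨h, g⟩ ⟨h', g'⟩ hx hxy hy
    rcases hxy with ⟨h1, h2⟩ | ⟨h1, h2, h3⟩
    · simp only at h1
      subst h1
      exact hx
    · simp only at h3
      subst h3
      cases h' with
      | pt c => exact absurd hy (hbig c)
      | mid c d i =>
        cases h with
        | pt e =>
          have hx : e = b := hx
          rcases h1 with h1 | h1
          · exact Or.inr ⟨h1.1.trans hx, by rw [h1.1]; exact h1.2.2⟩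
          · exact Or.inl (h1.1.symm.trans hx)
        | mid e f j =>
          have hx : f = b ∨ e = b ∧ R e f := hx
          show d = b ∨ c = b ∧ R c d
          rcases h1 with h1 | h1
          · rw [h1.1, h1.2.1]; exact hx
          · rw [← h1.1, ← h1.2.1]; exact hx
  have hSu : S u := step (.pt b, root n) u rfl hu hf
  have hSv : S v := by
    clear hv
    induction huv with
    | refl => exact hSu
    | tail _ h ih => exact step _ _ ih h.1 h.2
  obtain ⟨h, g⟩ := v
  rcases hv with ⟨h1, h2⟩ | ⟨h1, h2, h3⟩
  · simp only at h1
    subst h1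
    exact absurd hSv hab
  · cases h with
    | pt c => exact (h1.elim id id).elim
    | mid c d i =>
      have hS : d = b ∨ c = b ∧ R c d := hSv
      rcases h1 with h1 | h1
      · have h4 : a = d := h1.1
        rcases hS with h5 | ⟨h5, h6⟩
        · exact absurd (h4.trans h5) hab
        · exact Or.inr (by rwa [h4, ← h5])
      · have h4 : c = a := h1.1
        rcases hS with h5 | ⟨h5, h6⟩
        · exact Or.inl (by rw [← h5]; exact h1.2.2)
        · exact absurd (h4.symm.trans h5) hab

/-- The clause `a ≠ b` is necessary: every `pt a` is linked to itself by going to a neighbour of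
finite degree and back. -/
theorem rel_iff_linked (hR : ∀ a b, R a b → R b a) (hR' : ∀ a, ¬ R a a) {a b : ℕ} :
    R a b ↔ a ≠ b ∧ Linked (Adj R : Base n → Base n → Prop) (.pt a, root n) (.pt b, root n) := by
  constructor
  · intro h
    exact ⟨fun hab => hR' b (hab ▸ h), linked_of_rel h⟩
  · rintro ⟨h1, h2⟩
    exact (rel_of_linked h1.symm h2).elim (hR _ _) id

/-- The relation can be recovered from the graph. -/
theorem exists_perm_of_equiv {R' : ℕ → ℕ → Prop} (hR : ∀ a b, R a b → R b a) (hR0 : ∀ a, ¬ R a a)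
    (hR' : ∀ a b, R' a b → R' b a) (hR0' : ∀ a, ¬ R' a a) (e : Base n ≃ Base n)
    (he : ∀ x y, Adj R x y ↔ Adj R' (e x) (e y)) :
    ∃ σ : Equiv.Perm ℕ, ∀ a b, R a b ↔ R' (σ a) (σ b) := by
  have he' : ∀ x y, Adj R' x y ↔ Adj R (e.symm x) (e.symm y) := fun x y => by simp [he]
  have h1 : ∀ a, ∃ b, e (.pt a, root n) = (.pt b, root n) := fun a =>
    (infinite_adj_iff (R := R') _).1
      ((_root_.infinite_adj_iff e he _).2 ((infinite_adj_iff _).2 ⟨a, rfl⟩))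
  have h2 : ∀ a, ∃ b, e.symm (.pt a, root n) = (.pt b, root n) := fun a =>
    (infinite_adj_iff (R := R) _).1
      ((_root_.infinite_adj_iff e.symm he' _).2 ((infinite_adj_iff _).2 ⟨a, rfl⟩))
  choose f hf using h1
  choose g hg using h2
  refine ⟨⟨f, g, fun a => ?_, fun a => ?_⟩, fun a b => ?_⟩
  · have := hg (f a)
    rw [← hf, Equiv.symm_apply_apply] at this
    simpa using this.symm
  · have := hf (g a)
    rw [← hg, Equiv.apply_symm_apply] at this
    simpa using this.symm
  · rw [rel_iff_linked (n := n) hR hR0, rel_iff_linked (n := n) hR' hR0']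
    simp only [Equiv.coe_fn_mk]
    rw [← hf, ← hf]
    refine and_congr ?_ ⟨fun h => h.map e he, fun h => by simpa using h.map e.symm he'⟩
    have hinj : ∀ a b, f a = f b ↔ a = b := fun a b => by
      refine ⟨fun h => ?_, fun h => by rw [h]⟩
      have h3 := hf a
      rw [h, ← hf b] at h3
      simpa using e.injective h3
    rw [Ne, Ne, hinj]

/-- The action of permutations on the graph. -/
def perm (σ : Equiv.Perm ℕ) : Equiv.Perm (Base n) :=
  (Junction.perm σ).prodCongr (Equiv.refl _)

theorem adj_perm {R' : ℕ → ℕ → Prop} {σ : Equiv.Perm ℕ} (h : ∀ a b, R a b ↔ R' (σ a) (σ b))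
    (x y : Base n) : Adj R x y ↔ Adj R' (perm σ x) (perm σ y) := by
  refine or_congr (and_congr ?_ Iff.rfl) (and_congr (Junction.adj_perm h _ _) Iff.rfl)
  exact (Junction.perm σ).injective.eq_iff.symm

theorem color_perm (σ : Equiv.Perm ℕ) (x : Base n) : (perm σ x).color = x.color := by
  show xor (Junction.perm σ x.1).color x.2.2 = xor x.1.color x.2.2
  rw [Junction.color_perm]

theorem measurable_adj (x y : Base n) {X : Type*} [MeasurableSpace X] {R : X → ℕ → ℕ → Prop}
    (hR : ∀ a b, Measurable fun x => R x a b) : Measurable fun z => Adj (R z) x y := by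
  have := Junction.measurable_adj x.1 y.1 hR
  unfold Adj Inner Cross
  fun_prop

end Base

/-! ### Adding paths without creating short cycles. -/

/-- There is a walk of length at most `k` from `x` to `y`. -/
def Within {V : Type*} (E : V → V → Prop) : ℕ → V → V → Prop
  | 0, x, y => x = y
  | k + 1, x, y => x = y ∨ ∃ z, E x z ∧ Within E k z y

namespace Within

variable {V : Type*} {E : V → V → Prop}

theorem refl (k : ℕ) (x : V) : Within E k x x := by
  cases k
  · rfl
  · exact Or.inl rfl

theorem mono {k l : ℕ} (hkl : k ≤ l) {x y : V} (h : Within E k x y) : Within E l x y := by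
  induction k generalizing l x with
  | zero => rw [show x = y from h]; exact refl l y
  | succ k ih =>
    obtain ⟨l, rfl⟩ := Nat.exists_eq_add_of_le' (show 1 ≤ l by omega)
    exact h.imp id fun ⟨z, h1, h2⟩ => ⟨z, h1, ih (by omega) h2⟩

theorem of_walk {w : ℕ → V} (k s : ℕ) (h : ∀ i < k, E (w (s + i)) (w (s + i + 1))) :
    Within E k (w s) (w (s + k)) := by
  induction k generalizing s with
  | zero => rfl
  | succ k ih =>
    refine Or.inr ⟨w (s + 1), h 0 (by omega), ?_⟩
    have := ih (s + 1) fun i hi => by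
      have := h (i + 1) (by omega)
      rwa [show s + 1 + i = s + (i + 1) by ring]
    rwa [show s + 1 + k = s + (k + 1) by ring] at this

theorem symm (h : ∀ x y, E x y → E y x) {k : ℕ} {x y : V}
    (hw : Within E k x y) : Within E k y x := by
  have snoc : ∀ (k : ℕ) (x y z : V), Within E k x y → E y z → Within E (k + 1) x z := by
    intro k
    induction k with
    | zero =>
      rintro x y z hxy hz
      rw [show x = y from hxy]
      exact Or.inr ⟨z, hz, rfl⟩
    | succ k ih =>
      rintro x y z (rfl | ⟨u, h1, h2⟩) hz
      · exact Or.inr ⟨z, hz, Within.refl _ _⟩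
      · exact Or.inr ⟨u, h1, ih _ _ _ h2 hz⟩
  induction k generalizing x with
  | zero => exact Eq.symm hw
  | succ k ih =>
    rcases hw with rfl | ⟨z, h1, h2⟩
    · exact Within.refl _ _
    · exact snoc _ _ _ _ (ih h2) (h _ _ h1)

theorem map {W : Type*} {F : W → W → Prop} (f : V → W)
    (h : ∀ x y, E x y → F (f x) (f y)) {k : ℕ} {x y : V} (hw : Within E k x y) :
    Within F k (f x) (f y) := by
  induction k generalizing x with
  | zero => exact congrArg f hw
  | succ k ih => exact hw.imp (congrArg f) fun ⟨z, h1, h2⟩ => ⟨f z, h _ _ h1, ih h2⟩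

theorem exists_walk {G : SimpleGraph V} {k : ℕ} {x y : V} (h : Within G.Adj k x y) :
    ∃ p : G.Walk x y, p.length ≤ k := by
  induction k generalizing x with
  | zero => cases (show x = y from h); exact ⟨.nil, le_rfl⟩
  | succ k ih =>
    rcases h with rfl | ⟨z, h1, h2⟩
    · exact ⟨.nil, by simp⟩
    · obtain ⟨p, hp⟩ := ih h2
      exact ⟨.cons h1 p, by simpa using hp⟩

end Within

/-- The graph obtained from `E` by adding the paths `p x y 0, …, p x y (n - 1)` for all `x` and `y`
related by `Q`. -/
def addPaths {V : Type*} (n : ℕ) (E Q : V → V → Prop) (p : V → V → ℕ → V) (x y : V) : Prop :=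
  E x y ∨ ∃ a b i, Q a b ∧ i + 1 ≤ n - 1 ∧ x = p a b i ∧ y = p a b (i + 1)

/-- The conditions under which paths of length `n - 1` can be added to a bipartite graph without
creating a cycle of length less than `2 * n`. -/
structure IsPathSystem {V : Type*} (n : ℕ) (U : V → Prop) (E Q : V → V → Prop)
    (p : V → V → ℕ → V) (c : V → Bool) : Prop where
  three_le : 3 ≤ n
  adj_symm : ∀ x y, E x y → E y x
  adj_mem : ∀ x y, E x y → U x
  color_ne : ∀ x y, E x y → c x ≠ c y
  symm : ∀ x y, Q x y → Q y x
  mem : ∀ x y, Q x y → U x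
  far : ∀ x y, Q x y → ¬ Within E (n - 1) x y
  color_last : ∀ x y, Q x y → c y = xor (c x) (decide ((n - 1) % 2 = 1))
  zero : ∀ x y, p x y 0 = x
  last : ∀ x y, p x y (n - 1) = y
  reverse : ∀ x y i, Q x y → i ≤ n - 1 → p x y i = p y x (n - 1 - i)
  not_mem : ∀ x y i, Q x y → 0 < i → i < n - 1 → ¬ U (p x y i)
  inj : ∀ x y i x' y' i', Q x y → Q x' y' → 0 < i → i < n - 1 → 0 < i' → i' < n - 1 →
    p x y i = p x' y' i' → (x = x' ∧ y = y' ∧ i = i') ∨ (x = y' ∧ y = x' ∧ i' = n - 1 - i)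
  color_path : ∀ x y i, Q x y → i < n - 1 → c (p x y i) = xor (c x) (decide (i % 2 = 1))

namespace IsPathSystem

variable {V : Type*} {n : ℕ} {U : V → Prop} {E Q : V → V → Prop} {p : V → V → ℕ → V}
  {c : V → Bool} (h : IsPathSystem n U E Q p c)

include h

theorem addPaths_symm {x y : V} (hxy : addPaths n E Q p x y) : addPaths n E Q p y x := by
  rcases hxy with hxy | ⟨a, b, i, hab, hi, rfl, rfl⟩
  · exact Or.inl (h.adj_symm _ _ hxy)
  · refine Or.inr ⟨b, a, n - 1 - (i + 1), h.symm _ _ hab, by omega, h.reverse _ _ _ hab hi, ?_⟩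
    rw [h.reverse _ _ _ hab (by omega)]
    congr 1
    omega

theorem color_path' {x y : V} {i : ℕ} (hxy : Q x y) (hi : i ≤ n - 1) :
    c (p x y i) = xor (c x) (decide (i % 2 = 1)) := by
  rcases hi.lt_or_eq with hi | rfl
  · exact h.color_path _ _ _ hxy hi
  · rw [h.last, h.color_last _ _ hxy]

theorem addPaths_color_ne {x y : V} (hxy : addPaths n E Q p x y) : c x ≠ c y := by
  rcases hxy with hxy | ⟨a, b, i, hab, hi, rfl, rfl⟩
  · exact h.color_ne _ _ hxy
  · rw [h.color_path' hab hi, h.color_path' hab (by omega)]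
    rcases Nat.mod_two_eq_zero_or_one i with h2 | h2
    · simp [h2, Nat.add_mod]
    · simp [h2, Nat.add_mod]

/-- Interior vertices are new and belong to one path only, so they have no other neighbours. Both
the girth bound and the recovery of the starting graph depend on this. -/
theorem neighbor {a b y : V} {i : ℕ} (hab : Q a b) (hi : 0 < i) (hi' : i < n - 1)
    (hy : addPaths n E Q p (p a b i) y) : y = p a b (i - 1) ∨ y = p a b (i + 1) := by
  rcases hy with hy | ⟨a', b', j, hab', hj, h1, rfl⟩
  · exact absurd (h.adj_mem _ _ hy) (h.not_mem _ _ _ hab hi hi')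
  · rcases Nat.eq_zero_or_pos j with rfl | hj0
    · rw [h.zero] at h1
      exact absurd (h1 ▸ h.mem _ _ hab') (h.not_mem _ _ _ hab hi hi')
    · rcases h.inj _ _ _ _ _ _ hab hab' hi hi' hj0 hj h1 with ⟨rfl, rfl, rfl⟩ | ⟨rfl, rfl, rfl⟩
      · exact Or.inr rfl
      · left
        rw [h.reverse _ _ _ hab' hj]
        congr 1
        omega

/-- As n - 1 ≥ 2, every new edge has an interior vertex at one of its ends. -/
theorem old {x y : V} (hx : U x) (hy : U y) (hxy : addPaths n E Q p x y) : E x y := by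
  have := h.three_le
  rcases hxy with hxy | ⟨a, b, i, hab, hi, rfl, rfl⟩
  · exact hxy
  · exfalso
    rcases Nat.eq_zero_or_pos i with rfl | hi0
    · exact h.not_mem _ _ _ hab (by omega) (by omega) hy
    · exact h.not_mem _ _ _ hab hi0 (by omega) hx

theorem start {x y : V} (hx : U x) (hy : ¬ U y) (hxy : addPaths n E Q p x y) :
    ∃ b, Q x b ∧ y = p x b 1 := by
  rcases hxy with hxy | ⟨a, b, i, hab, hi, rfl, rfl⟩
  · exact absurd (h.adj_mem _ _ (h.adj_symm _ _ hxy)) hy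
  · rcases Nat.eq_zero_or_pos i with rfl | hi0
    · exact ⟨b, by rwa [h.zero], by rw [h.zero]⟩
    · exact absurd hx (h.not_mem _ _ _ hab hi0 (by omega))

/-- By `neighbor`, a walk without backtracking that has taken one edge of a path must follow it to
the end. -/
theorem run {w : ℕ → V} (hw : ∀ i, addPaths n E Q p (w i) (w (i + 1)))
    (hb : ∀ i, w i ≠ w (i + 2)) {a b : V} (hab : Q a b) {t i : ℕ}
    (h0 : w t = p a b i) (h1 : w (t + 1) = p a b (i + 1)) (j : ℕ) (hj : i + j + 1 ≤ n - 1) :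
    w (t + j) = p a b (i + j) ∧ w (t + j + 1) = p a b (i + j + 1) := by
  induction j with
  | zero => exact ⟨h0, h1⟩
  | succ j ih =>
    obtain ⟨h2, h3⟩ := ih (by omega)
    refine ⟨h3, ?_⟩
    have h4 := hw (t + j + 1)
    rw [h3] at h4
    rcases h.neighbor hab (by omega) (by omega) h4 with h5 | h5
    · rw [Nat.add_sub_cancel, ← h2] at h5
      exact absurd h5.symm (hb _)
    · exact h5

/-- Suppose the period k is less than 2n. If the walk uses new edges, it covers a whole path of
length n - 1. When the rest of the round is old, it joins the ends of that path in k - (n - 1)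
steps; as k is even this is at most n - 1, against `far`. When the rest contains a second path,
there is room for nothing else, so that path is the first one reversed and the walk backtracks. -/
theorem longPeriods (hE : LongPeriods E (2 * n)) : LongPeriods (addPaths n E Q p) (2 * n) := by
  have hn := h.three_le
  intro k w hk hw hb hp
  by_contra! hlt
  have hlast : ∀ x y, Q x y → U (p x y (n - 1)) := fun x y hxy => by
    rw [h.last]; exact h.mem _ _ (h.symm _ _ hxy)
  have hU : ∃ t, U (w t) := by
    by_contra! hU
    rcases hw 0 with h0 | ⟨a, b, i, hab, hi, h0, h1⟩
    · exact hU 0 (h.adj_mem _ _ h0)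
    · have := (h.run hw hb hab h0 h1 (n - 1 - (i + 1)) (by omega)).2
      rw [show i + (n - 1 - (i + 1)) + 1 = n - 1 by omega] at this
      exact hU _ (this ▸ hlast _ _ hab)
  -- The first step after `s` that is not old starts at an old vertex and enters the interior of a
  -- path.
  have exit : ∀ s, U (w s) → (∃ t, s ≤ t ∧ ¬ E (w t) (w (t + 1))) →
      ∃ t, s ≤ t ∧ U (w t) ∧ ¬ U (w (t + 1)) ∧ ∀ i, s ≤ i → i < t → E (w i) (w (i + 1)) := by
    classical
    intro s hs hex
    obtain ⟨h1, h2⟩ := Nat.find_spec hex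
    have hmin : ∀ i, s ≤ i → i < Nat.find hex → E (w i) (w (i + 1)) := fun i hi hi' => by
      have := Nat.find_min hex hi'
      push Not at this
      exact this hi
    have h3 : U (w (Nat.find hex)) := by
      rcases h1.eq_or_lt with h4 | h4
      · rw [← h4]; exact hs
      · have h5 := hmin (Nat.find hex - 1) (by omega) (by omega)
        rw [show Nat.find hex - 1 + 1 = Nat.find hex by omega] at h5
        exact h.adj_mem _ _ (h.adj_symm _ _ h5)
    exact ⟨_, h1, h3, fun h4 => h2 (h.old h3 h4 (hw _)), hmin⟩
  have enter : ∀ t, U (w t) → ¬ U (w (t + 1)) →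
      ∃ b, Q (w t) b ∧ ∀ j ≤ n - 1, w (t + j) = p (w t) b j := by
    intro t h1 h2
    obtain ⟨b, hb1, hb2⟩ := h.start h1 h2 (hw t)
    refine ⟨b, hb1, fun j hj => ?_⟩
    have hr := h.run hw hb hb1 (h.zero _ _).symm (by rw [hb2])
    rcases hj.lt_or_eq with hj | rfl
    · have := (hr j (by omega)).1
      rwa [zero_add] at this
    · have := (hr (n - 1 - 1) (by omega)).2
      rwa [zero_add, show t + (n - 1 - 1) + 1 = t + (n - 1) by omega,
        show n - 1 - 1 + 1 = n - 1 by omega] at this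
  have leave : ∀ t j, U (w t) → ¬ U (w (t + 1)) → 0 < j → U (w (t + j)) → n - 1 ≤ j := by
    intro t j h1 h2 h3 h4
    obtain ⟨b, hb1, hb2⟩ := enter t h1 h2
    by_contra! hj
    rw [hb2 j hj.le] at h4
    exact h.not_mem _ _ _ hb1 h3 hj h4
  obtain ⟨s, hs⟩ := hU
  by_cases hall : ∀ t, s ≤ t → E (w t) (w (t + 1))
  · have := hE k (fun i => w (s + i)) hk (fun i => hall _ (by omega)) (fun i => hb _)
      (fun i => by have := hp (s + i); rwa [add_assoc] at this)
    omega
  push Not at hall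
  obtain ⟨t, -, ht1, ht2, -⟩ := exit s hs hall
  obtain ⟨b, hQ, hpath⟩ := enter t ht1 ht2
  have hret : U (w (t + k)) := by rwa [hp]
  have hk1 := leave t k ht1 ht2 hk hret
  have hkeven : k % 2 = 0 := by
    have : ∀ j, c (w (t + j)) = xor (c (w t)) (decide (j % 2 = 1)) := by
      intro j
      induction j with
      | zero => simp
      | succ j ih =>
        have h1 := h.addPaths_color_ne (hw (t + j))
        rw [ih] at h1
        rw [show t + (j + 1) = t + j + 1 by ring]
        generalize c (w (t + j + 1)) = d at h1
        generalize c (w t) = e at h1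
        rcases Nat.mod_two_eq_zero_or_one j with h2 | h2 <;>
          cases d <;> cases e <;> simp [h2, Nat.add_mod] at h1 ⊢
    have h1 := this k
    rw [hp] at h1
    by_contra h2
    have h3 : k % 2 = 1 := by omega
    simp [h3] at h1
  have hb' : w (t + (n - 1)) = b := by rw [hpath _ le_rfl, h.last]
  by_cases hall' : ∀ i, t + (n - 1) ≤ i → i < t + k → E (w i) (w (i + 1))
  · have h1 := Within.of_walk (E := E) (w := w) (k - (n - 1)) (t + (n - 1)) fun i hi =>
      hall' _ (by omega) (by omega)
    rw [hb', show t + (n - 1) + (k - (n - 1)) = t + k by omega, hp] at h1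
    exact h.far _ _ (h.symm _ _ hQ) (h1.mono (by omega))
  · push Not at hall'
    obtain ⟨i, hi1, hi2, hi3⟩ := hall'
    obtain ⟨t', h1, h2, h3, h4⟩ := exit (t + (n - 1)) (by rw [hb']; exact h.mem _ _ (h.symm _ _ hQ))
      ⟨i, hi1, hi3⟩
    have h5 : t' ≤ i := by
      by_contra! h5
      exact hi3 (h4 i hi1 h5)
    have h6 := leave t' (t + k - t') h2 h3 (by omega)
      (by rwa [show t' + (t + k - t') = t + k by omega])
    have h7 : t' = t + (n - 1) := by omega
    obtain ⟨b'', hQ', hpath'⟩ := enter t' h2 h3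
    have h8 : w t' = b := by rw [h7, hb']
    have h9 : b'' = w t := by
      have := hpath' (n - 1) le_rfl
      rw [h.last, show t' + (n - 1) = t + k by omega, hp] at this
      exact this.symm
    -- The second path goes from `b` back to `w t`, so by `reverse` the vertex after `b` is the
    -- vertex before it.
    have h10 := hpath' 1 (by omega)
    rw [h8, h9, h.reverse _ _ _ (h.symm _ _ hQ) (by omega), ← hpath _ (by omega), h7] at h10
    refine hb (t + (n - 1 - 1)) ?_
    rw [← h10]
    congr 1
    omega

end IsPathSystem

/-! ### Names for the vertices of the completion. -/

/-- Names for the vertices of the free completion of a graph on `B`: `arc k x y i` is the `i`-th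
interior vertex of the path added at stage `k` between `x` and `y`. -/
inductive PathTerm (B : Type) : Type
  | base (b : B) : PathTerm B
  | arc (k : ℕ) (x y : PathTerm B) (i : ℕ) : PathTerm B

namespace PathTerm

variable {B : Type}

theorem base_injective : Function.Injective (base (B := B)) := fun _ _ h => PathTerm.base.inj h

instance [Countable B] : Countable (PathTerm B) := by
  obtain ⟨f, hf⟩ := exists_injective_nat B
  let g : PathTerm B → ℕ := fun t => PathTerm.rec (motive := fun _ => ℕ) (fun b => 2 * f b)
    (fun k _ _ i x y => 2 * Nat.pair (Nat.pair x y) (Nat.pair k i) + 1) t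
  have hg1 : ∀ b, g (base b) = 2 * f b := fun _ => rfl
  have hg2 : ∀ k x y i, g (arc k x y i) =
      2 * Nat.pair (Nat.pair (g x) (g y)) (Nat.pair k i) + 1 := fun _ _ _ _ => rfl
  have : Function.Injective g := by
    intro t
    induction t with
    | base b =>
      intro t' h
      cases t' with
      | base b' =>
        rw [hg1, hg1] at h
        rw [hf (show f b = f b' by omega)]
      | arc k x y i => rw [hg1, hg2] at h; omega
    | arc k x y i ihx ihy =>
      intro t' h
      cases t' with
      | base b' => rw [hg1, hg2] at h; omega
      | arc k' x' y' i' =>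
        rw [hg2, hg2] at h
        have h1 := Nat.pair_eq_pair.1 (show Nat.pair (Nat.pair (g x) (g y)) (Nat.pair k i) =
          Nat.pair (Nat.pair (g x') (g y')) (Nat.pair k' i') by omega)
        have h2 := Nat.pair_eq_pair.1 h1.1
        have h3 := Nat.pair_eq_pair.1 h1.2
        rw [ihx h2.1, ihy h2.2, h3.1, h3.2]
  exact this.countable

/-- An arbitrary enumeration of the names, which orients the paths. -/
noncomputable def index [Countable B] : PathTerm B → ℕ :=
  Classical.choose (exists_injective_nat (PathTerm B))

theorem index_injective [Countable B] : Function.Injective (index (B := B)) :=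
  Classical.choose_spec (exists_injective_nat (PathTerm B))

/-- The vertices of the path of length `n - 1` that is added at stage `k` between `x` and `y`. -/
noncomputable def point [Countable B] (n k : ℕ) (x y : PathTerm B) (i : ℕ) : PathTerm B :=
  if i = 0 then x else if i = n - 1 then y
  else if index x < index y then arc k x y i else arc k y x (n - 1 - i)

/-- The colouring of the free completion. -/
def color (c : B → Bool) : PathTerm B → Bool
  | base b => c b
  | arc _ x _ i => xor (color c x) (decide (i % 2 = 1))

/-- The name can only belong to a vertex that is added before stage `k`. -/
def Before (k : ℕ) : PathTerm B → Prop
  | base _ => True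
  | arc j _ _ _ => j < k

variable [Countable B] {n k : ℕ} {x y x' y' : PathTerm B}

theorem point_zero : point n k x y 0 = x := by simp [point]

theorem point_last (hn : 3 ≤ n) : point n k x y (n - 1) = y := by
  simp [point, show n - 1 ≠ 0 by omega]

theorem point_interior {i : ℕ} (hi : 0 < i) (hi' : i < n - 1) :
    point n k x y i = if index x < index y then arc k x y i else arc k y x (n - 1 - i) := by
  simp [point, hi.ne', hi'.ne]

/-- An unordered pair receives a single path, named from the end of smaller index. For `x = y` there
would be no smaller end, and the equation fails. -/
theorem point_reverse (hn : 3 ≤ n) (hxy : x ≠ y) {i : ℕ} (hi : i ≤ n - 1) :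
    point n k x y i = point n k y x (n - 1 - i) := by
  rcases Nat.eq_zero_or_pos i with rfl | h0
  · rw [point_zero, Nat.sub_zero, point_last hn]
  rcases hi.eq_or_lt with rfl | h1
  · rw [point_last hn, Nat.sub_self, point_zero]
  rw [point_interior h0 h1, point_interior (by omega) (by omega)]
  have h2 : index x ≠ index y := fun h => hxy (index_injective h)
  rcases h2.lt_or_gt with h2 | h2
  · rw [if_pos h2, if_neg h2.not_gt]
    congr 1
    omega
  · rw [if_neg h2.not_gt, if_pos h2]

theorem point_inj {i i' : ℕ} (hi : 0 < i) (hi' : i < n - 1) (hj : 0 < i') (hj' : i' < n - 1)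
    (h : point n k x y i = point n k x' y' i') :
    (x = x' ∧ y = y' ∧ i = i') ∨ (x = y' ∧ y = x' ∧ i' = n - 1 - i) := by
  rw [point_interior hi hi', point_interior hj hj'] at h
  split_ifs at h <;> simp only [arc.injEq, true_and] at h
  · exact Or.inl h
  · exact Or.inr ⟨h.1, h.2.1, by omega⟩
  · exact Or.inr ⟨h.2.1, h.1, by omega⟩
  · exact Or.inl ⟨h.2.1, h.1, by omega⟩

/-- The stage recorded in a name makes the interior vertices fresh. -/
theorem not_before_point {i : ℕ} (hi : 0 < i) (hi' : i < n - 1) :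
    ¬ Before k (point n k x y i) := by
  rw [point_interior hi hi']
  split_ifs <;> simp [Before]

theorem before_point {i : ℕ} (hx : Before k x) (hy : Before k y) :
    Before (k + 1) (point n k x y i) := by
  have mono : ∀ z : PathTerm B, Before k z → Before (k + 1) z := by
    intro z hz
    cases z with
    | base b => trivial
    | arc j _ _ _ => exact Nat.lt_succ_of_lt hz
  unfold point
  split_ifs
  · exact mono _ hx
  · exact mono _ hy
  · simp [Before]
  · simp [Before]

/-- The hypothesis on the colours of the ends makes counting from `y` agree with counting from `x`.
-/
theorem color_point {c : B → Bool} (h : color c y = xor (color c x) (decide ((n - 1) % 2 = 1)))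
    {i : ℕ} (hi : i < n - 1) :
    color c (point n k x y i) = xor (color c x) (decide (i % 2 = 1)) := by
  rcases Nat.eq_zero_or_pos i with rfl | h0
  · simp [point_zero]
  rw [point_interior h0 hi]
  split_ifs
  · rfl
  · show xor (color c y) (decide ((n - 1 - i) % 2 = 1)) = _
    rw [h, Bool.xor_assoc]
    congr 1
    have key : (n - 1 - i) % 2 = 1 ↔ ¬ ((n - 1) % 2 = 1 ↔ i % 2 = 1) := by omega
    by_cases h1 : (n - 1) % 2 = 1 <;> by_cases h2 : i % 2 = 1 <;> simp [key, h1, h2]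

end PathTerm

/-! ### The free completion and its core. -/

open PathTerm

/-- The pairs of vertices that are joined by a path of length `n - 1` in one stage of the free
completion. -/
def Far {V : Type} (n : ℕ) (c : V → Bool) (U : V → Prop) (E : V → V → Prop) (x y : V) : Prop :=
  U x ∧ U y ∧ c y = xor (c x) (decide ((n - 1) % 2 = 1)) ∧ ¬ Within E (n - 1) x y

section Completion

variable {B : Type} [Countable B]

/-- The stages of the free completion of the graph `R`: vertices and adjacency. -/
noncomputable def stage (n : ℕ) (c : B → Bool) (R : B → B → Prop) :
    ℕ → (PathTerm B → Prop) × (PathTerm B → PathTerm B → Prop)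
  | 0 => (fun x => ∃ b, x = base b, fun x y => ∃ a b, R a b ∧ x = base a ∧ y = base b)
  | k + 1 =>
    let Q := Far n (color c) (stage n c R k).1 (stage n c R k).2
    (fun z => (stage n c R k).1 z ∨ ∃ x y i, Q x y ∧ i ≤ n - 1 ∧ z = point n k x y i,
      addPaths n (stage n c R k).2 Q (point n k))

/-- A bipartite graph without isolated vertices and without cycles of length less than `2 * n`. -/
structure IsPartialPolygon (n : ℕ) (c : B → Bool) (R : B → B → Prop) : Prop where
  three_le : 3 ≤ n
  symm : ∀ x y, R x y → R y x
  color_ne : ∀ x y, R x y → c x ≠ c y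
  exists_adj : ∀ x, ∃ y, R x y
  longPeriods : LongPeriods R (2 * n)

variable {n : ℕ} {c : B → Bool} {R : B → B → Prop}

theorem longPeriods_base (h : LongPeriods R (2 * n)) :
    LongPeriods (stage n c R 0).2 (2 * n) := by
  intro k w hk hw hb hp
  choose f g hf using hw
  have h1 : ∀ i, g i = f (i + 1) := fun i =>
    base_injective ((hf i).2.2.symm.trans (hf (i + 1)).2.1)
  refine h k f hk (fun i => ?_) (fun i hi => hb i ?_) (fun i => ?_)
  · rw [← h1]; exact (hf i).1
  · rw [(hf i).2.1, (hf (i + 2)).2.1, hi]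
  · refine base_injective ?_
    rw [← (hf _).2.1, ← (hf i).2.1, hp]

/-- The properties of the stages that are preserved by the construction. -/
structure StageInvariant (n : ℕ) (c : B → Bool) (R : B → B → Prop) (k : ℕ) : Prop where
  symm : ∀ x y, (stage n c R k).2 x y → (stage n c R k).2 y x
  mem : ∀ x y, (stage n c R k).2 x y → (stage n c R k).1 x
  color_ne : ∀ x y, (stage n c R k).2 x y → color c x ≠ color c y
  before : ∀ x, (stage n c R k).1 x → Before k x
  longPeriods : LongPeriods (stage n c R k).2 (2 * n)

theorem StageInvariant.isPathSystem (hn : 3 ≤ n) {k : ℕ} (h : StageInvariant n c R k) :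
    IsPathSystem n (stage n c R k).1 (stage n c R k).2
      (Far n (color c) (stage n c R k).1 (stage n c R k).2) (point n k) (color c) := by
  have hne : ∀ x y, Far n (color c) (stage n c R k).1 (stage n c R k).2 x y → x ≠ y := by
    rintro x y hxy rfl
    exact hxy.2.2.2 (Within.refl _ _)
  exact {
    three_le := hn
    adj_symm := h.symm
    adj_mem := h.mem
    color_ne := h.color_ne
    symm := fun x y hxy => ⟨hxy.2.1, hxy.1, by rw [hxy.2.2.1]; simp,
      fun hw => hxy.2.2.2 (hw.symm h.symm)⟩
    mem := fun x y hxy => hxy.1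
    far := fun x y hxy => hxy.2.2.2
    color_last := fun x y hxy => hxy.2.2.1
    zero := fun x y => point_zero
    last := fun x y => point_last hn
    reverse := fun x y i hxy hi => point_reverse hn (hne _ _ hxy) hi
    not_mem := fun x y i _ hi hi' hU => not_before_point hi hi' (h.before _ hU)
    inj := fun x y i x' y' i' _ _ hi hi' hj hj' he => point_inj hi hi' hj hj' he
    color_path := fun x y i hxy hi => color_point hxy.2.2.1 hi }

theorem IsPartialPolygon.stageInvariant (h : IsPartialPolygon n c R) (k : ℕ) :
    StageInvariant n c R k := by
  induction k with
  | zero =>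
    exact {
      symm := by
        rintro _ _ ⟨a, b, hab, rfl, rfl⟩
        exact ⟨b, a, h.symm _ _ hab, rfl, rfl⟩
      mem := by
        rintro _ _ ⟨a, b, hab, rfl, rfl⟩
        exact ⟨a, rfl⟩
      color_ne := by
        rintro _ _ ⟨a, b, hab, rfl, rfl⟩
        exact h.color_ne _ _ hab
      before := by
        rintro _ ⟨a, rfl⟩
        trivial
      longPeriods := longPeriods_base h.longPeriods }
  | succ k ih =>
    have hs := ih.isPathSystem h.three_le
    exact {
      symm := fun x y => hs.addPaths_symm
      mem := by
        rintro x y (hxy | ⟨a, b, i, hab, hi, rfl, rfl⟩)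
        · exact Or.inl (ih.mem _ _ hxy)
        · exact Or.inr ⟨a, b, i, hab, by omega, rfl⟩
      color_ne := fun x y => hs.addPaths_color_ne
      before := by
        rintro x (hx | ⟨a, b, i, hab, hi, rfl⟩)
        · have := before_point (n := n) (i := 0) (ih.before _ hx) (ih.before _ hx)
          rwa [point_zero] at this
        · exact before_point (ih.before _ hab.1) (ih.before _ hab.2.1)
      longPeriods := hs.longPeriods ih.longPeriods }

/-- The vertices of the free completion. -/
def IsVertex (n : ℕ) (c : B → Bool) (R : B → B → Prop) (x : PathTerm B) : Prop :=
  ∃ k, (stage n c R k).1 x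

/-- Adjacency in the free completion. -/
def CompletionAdj (n : ℕ) (c : B → Bool) (R : B → B → Prop) (x y : PathTerm B) : Prop :=
  ∃ k, (stage n c R k).2 x y

theorem stage_mono {k l : ℕ} (hkl : k ≤ l) {x : PathTerm B} (hx : (stage n c R k).1 x) :
    (stage n c R l).1 x := by
  induction hkl with
  | refl => exact hx
  | step _ ih => exact Or.inl ih

theorem stage_adj_mono {k l : ℕ} (hkl : k ≤ l) {x y : PathTerm B} (hx : (stage n c R k).2 x y) :
    (stage n c R l).2 x y := by
  induction hkl with
  | refl => exact hx
  | step _ ih => exact Or.inl ih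

namespace IsPartialPolygon

variable (h : IsPartialPolygon n c R)

include h

/-- By `IsPathSystem.old` no later stage joins vertices already present, so each stage is an induced
subgraph and finite configurations can be examined in a single stage. -/
theorem stage_adj_of_completionAdj {k : ℕ} {x y : PathTerm B} (hx : (stage n c R k).1 x)
    (hy : (stage n c R k).1 y) (hxy : CompletionAdj n c R x y) : (stage n c R k).2 x y := by
  obtain ⟨l, hl⟩ := hxy
  have down : ∀ m, (stage n c R (k + m)).2 x y → (stage n c R k).2 x y := by
    intro m
    induction m with
    | zero => exact id
    | succ m ih =>
      intro hm
      exact ih (((h.stageInvariant (k + m)).isPathSystem h.three_le).old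
        (stage_mono (by omega) hx) (stage_mono (by omega) hy) hm)
  exact down l (stage_adj_mono (by omega) hl)

theorem completionAdj_symm {x y : PathTerm B} (hxy : CompletionAdj n c R x y) :
    CompletionAdj n c R y x :=
  hxy.imp fun k => (h.stageInvariant k).symm x y

theorem isVertex_left {x y : PathTerm B} (hxy : CompletionAdj n c R x y) : IsVertex n c R x :=
  hxy.imp fun k => (h.stageInvariant k).mem x y

theorem completionAdj_color_ne {x y : PathTerm B} (hxy : CompletionAdj n c R x y) :
    color c x ≠ color c y :=
  hxy.elim fun k => (h.stageInvariant k).color_ne x y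

theorem completionAdj_base {a b : B} : CompletionAdj n c R (base a) (base b) ↔ R a b := by
  constructor
  · intro hab
    obtain ⟨a', b', h1, h2, h3⟩ :=
      h.stage_adj_of_completionAdj (k := 0) ⟨a, rfl⟩ ⟨b, rfl⟩ hab
    rwa [base_injective h2, base_injective h3]
  · exact fun hab => ⟨0, a, b, hab, rfl, rfl⟩

/-- A periodic walk visits finitely many vertices and so lies in one stage. -/
theorem completionAdj_longPeriods : LongPeriods (CompletionAdj n c R) (2 * n) := by
  intro k w hk hw hb hp
  choose l hl using fun i => h.isVertex_left (hw i)
  set m := (Finset.range k).sup l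
  have hmod : ∀ i, w i = w (i % k) := by
    intro i
    have : ∀ q r, w (r + q * k) = w r := by
      intro q r
      induction q with
      | zero => simp
      | succ q ih => rw [add_mul, one_mul, ← add_assoc, hp, ih]
    conv_lhs => rw [← Nat.mod_add_div i k, mul_comm, this]
  have hm : ∀ i, (stage n c R m).1 (w i) := fun i => by
    rw [hmod i]
    exact stage_mono (Finset.le_sup (Finset.mem_range.2 (Nat.mod_lt _ hk))) (hl _)
  exact (h.stageInvariant m).longPeriods k w hk
    (fun i => h.stage_adj_of_completionAdj (hm _) (hm _) (hw i)) hb hp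

theorem exists_completionAdj {x : PathTerm B} (hx : IsVertex n c R x) :
    ∃ y, CompletionAdj n c R x y := by
  obtain ⟨k, hk⟩ := hx
  induction k with
  | zero =>
    obtain ⟨b, rfl⟩ := hk
    obtain ⟨a, ha⟩ := h.exists_adj b
    exact ⟨_, h.completionAdj_base.2 ha⟩
  | succ k ih =>
    rcases hk with hk | ⟨a, b, i, hab, hi, rfl⟩
    · exact ih hk
    · rcases hi.lt_or_eq with hi | rfl
      · exact ⟨_, k + 1, Or.inr ⟨a, b, i, hab, hi, rfl, rfl⟩⟩
      · exact ih (by rw [point_last h.three_le]; exact hab.2.1)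

/-- If the two vertices are still too far apart at a stage containing both, the next stage joins
them. -/
theorem within_completionAdj_of_color {x y : PathTerm B} (hx : IsVertex n c R x)
    (hy : IsVertex n c R y) (hc : color c y = xor (color c x) (decide ((n - 1) % 2 = 1))) :
    Within (CompletionAdj n c R) (n - 1) x y := by
  obtain ⟨k, hk⟩ := hx
  obtain ⟨l, hl⟩ := hy
  set m := max k l
  have hx : (stage n c R m).1 x := stage_mono (le_max_left _ _) hk
  have hy : (stage n c R m).1 y := stage_mono (le_max_right _ _) hl
  by_cases hw : Within (stage n c R m).2 (n - 1) x y
  · exact hw.map id fun x y hxy => ⟨m, hxy⟩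
  · have hQ : Far n (color c) (stage n c R m).1 (stage n c R m).2 x y := ⟨hx, hy, hc, hw⟩
    have := Within.of_walk (E := CompletionAdj n c R) (w := point n m x y) (n - 1) 0 fun i hi =>
      ⟨m + 1, Or.inr ⟨x, y, i, hQ, by omega, by simp, by simp⟩⟩
    rwa [point_zero, zero_add, point_last h.three_le] at this

theorem within_completionAdj {x y : PathTerm B} (hx : IsVertex n c R x)
    (hy : IsVertex n c R y) : Within (CompletionAdj n c R) n x y := by
  have hn := h.three_le
  by_cases hc : color c y = xor (color c x) (decide ((n - 1) % 2 = 1))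
  · exact (h.within_completionAdj_of_color hx hy hc).mono (by omega)
  · obtain ⟨z, hz⟩ := h.exists_completionAdj hx
    have h1 := h.completionAdj_color_ne hz
    have h2 := h.within_completionAdj_of_color (h.isVertex_left (h.completionAdj_symm hz)) hy (by
      revert h1 hc
      generalize color c x = p
      generalize color c y = q
      generalize color c z = r
      generalize decide ((n - 1) % 2 = 1) = s
      revert p q r s
      decide)
    exact Within.mono (k := n - 1 + 1) (by omega) (Or.inr ⟨z, hz, h2⟩)

/-- The original graph consists of the vertices of the finite subgraphs of minimal degree at least
three of the free completion. -/
theorem inCore_completionAdj_iff (hR : ∀ b, InCore R b) (x : PathTerm B) :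
    InCore (CompletionAdj n c R) x ↔ ∃ b, x = base b := by
  constructor
  · rintro ⟨S, hfin, hx, hS⟩
    have hmem : ∀ u ∈ S, ∃ k, (stage n c R k).1 u := by
      intro u hu
      have : {v | v ∈ S ∧ CompletionAdj n c R u v}.ncard ≠ 0 := by
        have := hS u hu
        omega
      obtain ⟨v, hv⟩ := Set.nonempty_of_ncard_ne_zero this
      exact h.isVertex_left hv.2
    have hk : ∃ k, ∀ u ∈ S, (stage n c R k).1 u := by
      choose! f hf using hmem
      refine ⟨hfin.toFinset.sup f, fun u hu => stage_mono (Finset.le_sup ?_) (hf u hu)⟩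
      simpa using hu
    obtain ⟨k, hk⟩ := hk
    -- If the subgraph lies in stage k + 1, it lies in stage k: an interior vertex of a path just
    -- added has only two neighbours there, not three.
    have down : ∀ k, (∀ u ∈ S, (stage n c R k).1 u) → ∀ u ∈ S, (stage n c R 0).1 u := by
      intro k
      induction k with
      | zero => exact id
      | succ k ih =>
        intro hk
        refine ih fun u hu => ?_
        rcases hk u hu with h1 | ⟨a, b, i, hab, hi, rfl⟩
        · exact h1
        · rcases Nat.eq_zero_or_pos i with rfl | hi0
          · rw [point_zero]; exact hab.1
          rcases hi.eq_or_lt with rfl | hi1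
          · rw [point_last h.three_le]; exact hab.2.1
          exfalso
          have h3 := hS _ hu
          have h4 : {v | v ∈ S ∧ CompletionAdj n c R (point n k a b i) v} ⊆
              {point n k a b (i - 1), point n k a b (i + 1)} := by
            rintro v ⟨hv, huv⟩
            exact ((h.stageInvariant k).isPathSystem h.three_le).neighbor hab hi0 hi1
              (h.stage_adj_of_completionAdj (k := k + 1) (hk _ hu) (hk _ hv) huv)
          have h5 := Set.ncard_le_ncard h4 (Set.toFinite _)
          have h6 := Set.ncard_insert_le (point n k a b (i - 1)) {point n k a b (i + 1)}
          rw [Set.ncard_singleton] at h6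
          omega
    exact down k hk x hx
  · rintro ⟨b, rfl⟩
    obtain ⟨S, hfin, hb, hS⟩ := hR b
    refine ⟨base '' S, hfin.image _, ⟨b, hb, rfl⟩, ?_⟩
    rintro _ ⟨a, ha, rfl⟩
    have : {v | v ∈ base '' S ∧ CompletionAdj n c R (base a) v} =
        base '' {v | v ∈ S ∧ R a v} := by
      ext v
      constructor
      · rintro ⟨⟨d, hd, rfl⟩, hv⟩
        exact ⟨d, ⟨hd, h.completionAdj_base.1 hv⟩, rfl⟩
      · rintro ⟨d, ⟨hd, hd'⟩, rfl⟩
        exact ⟨⟨d, hd, rfl⟩, h.completionAdj_base.2 hd'⟩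
    rw [this, Set.ncard_image_of_injective _ base_injective]
    exact hS a ha

end IsPartialPolygon

end Completion

/-! ### Functoriality of the completion. -/

open PathTerm

/-- An isomorphism of coloured graphs. -/
structure ColorIso {B : Type} (c : B → Bool) (R R' : B → B → Prop) (e : Equiv.Perm B) : Prop where
  adj : ∀ a b, R a b ↔ R' (e a) (e b)
  color : ∀ a, c (e a) = c a

theorem ColorIso.symm {B : Type} {c : B → Bool} {R R' : B → B → Prop} {e : Equiv.Perm B} (h : ColorIso c R R' e) : ColorIso c R' R e.symm where
  adj a b := by rw [h.adj]; simp
  color a := by rw [← h.color]; simp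

section Lift

variable {B : Type} [Countable B] {n : ℕ} {c : B → Bool} {R R' : B → B → Prop}

/-- The map of names induced by a map of graphs. -/
noncomputable def PathTerm.lift (n : ℕ) (e : B → B) : PathTerm B → PathTerm B
  | base b => base (e b)
  | arc k x y i => point n k (lift n e x) (lift n e y) i

/-- The map need not preserve the order of the indices, so the image of a path may be named from its
other end; `point_reverse` absorbs this. -/
theorem PathTerm.lift_point (hn : 3 ≤ n) {e : B → B} {k i : ℕ} {x y : PathTerm B}
    (h : lift n e x ≠ lift n e y) (hi : i ≤ n - 1) :
    lift n e (point n k x y i) = point n k (lift n e x) (lift n e y) i := by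
  rcases Nat.eq_zero_or_pos i with rfl | h0
  · rw [point_zero, point_zero]
  rcases hi.eq_or_lt with rfl | h1
  · rw [point_last hn, point_last hn]
  rw [point_interior (x := x) h0 h1]
  split_ifs
  · rfl
  · rw [point_reverse hn h hi]
    rfl

/-- The induction treats all isomorphisms at once because it also needs the inverse: paths are added
between vertices that are far apart, and being far is preserved only if walks can be pulled back.
The maps on names are mutually inverse on actual vertices only. -/
theorem ColorIso.stage_lift (hn : 3 ≤ n) (k : ℕ) : ∀ {R R' : B → B → Prop} {e : Equiv.Perm B},
    ColorIso c R R' e →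
    (∀ x, (stage n c R k).1 x → (stage n c R' k).1 (lift n e x) ∧
      PathTerm.color c (lift n e x) = PathTerm.color c x ∧ lift n e.symm (lift n e x) = x) ∧
    ∀ x y, (stage n c R k).2 x y → (stage n c R' k).2 (lift n e x) (lift n e y) := by
  induction k with
  | zero =>
    intro R R' e h
    refine ⟨?_, ?_⟩
    · rintro _ ⟨b, rfl⟩
      exact ⟨⟨e b, rfl⟩, h.color b, by simp [lift]⟩
    · rintro _ _ ⟨a, b, hab, rfl, rfl⟩
      exact ⟨e a, e b, (h.adj _ _).1 hab, rfl, rfl⟩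
  | succ k ih =>
    intro R R' e h
    obtain ⟨hU, hE⟩ := ih h
    obtain ⟨hU', hE'⟩ := ih h.symm
    have far : ∀ x y, Far n (PathTerm.color c) (stage n c R k).1 (stage n c R k).2 x y →
        Far n (PathTerm.color c) (stage n c R' k).1 (stage n c R' k).2
          (lift n e x) (lift n e y) := by
      rintro x y ⟨h1, h2, h3, h4⟩
      refine ⟨(hU x h1).1, (hU y h2).1, ?_, fun hw => h4 ?_⟩
      · rw [(hU x h1).2.1, (hU y h2).2.1, h3]
      · have := hw.map _ hE'
        rwa [(hU x h1).2.2, (hU y h2).2.2] at this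
    have ne : ∀ {R : B → B → Prop} {x y},
        Far n (PathTerm.color c) (stage n c R k).1 (stage n c R k).2 x y → x ≠ y := by
      rintro R x y hxy rfl
      exact hxy.2.2.2 (Within.refl _ _)
    refine ⟨?_, ?_⟩
    · rintro x (hx | ⟨a, b, i, hab, hi, rfl⟩)
      · exact ⟨Or.inl (hU x hx).1, (hU x hx).2⟩
      · have hab' := far _ _ hab
        have h1 := hU a hab.1
        have h2 := hU b hab.2.1
        rw [lift_point hn (ne hab') hi]
        refine ⟨Or.inr ⟨_, _, i, hab', hi, rfl⟩, ?_, ?_⟩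
        · rcases hi.lt_or_eq with hi | rfl
          · rw [color_point hab'.2.2.1 hi, color_point hab.2.2.1 hi, h1.2.1]
          · rw [point_last hn, point_last hn, h2.2.1]
        · rw [lift_point hn (by rw [h1.2.2, h2.2.2]; exact ne hab) hi, h1.2.2, h2.2.2]
    · rintro x y (hxy | ⟨a, b, i, hab, hi, rfl, rfl⟩)
      · exact Or.inl (hE x y hxy)
      · have hab' := far _ _ hab
        refine Or.inr ⟨_, _, i, hab', hi, ?_, ?_⟩
        · rw [lift_point hn (ne hab') (by omega)]
        · rw [lift_point hn (ne hab') hi]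

namespace ColorIso

variable {e : Equiv.Perm B} (h : ColorIso c R R' e) (hn : 3 ≤ n)

include h hn

theorem isVertex_lift {x : PathTerm B} (hx : IsVertex n c R x) : IsVertex n c R' (lift n e x) :=
  hx.imp fun k hk => ((h.stage_lift hn k).1 x hk).1

theorem color_lift {x : PathTerm B} (hx : IsVertex n c R x) :
    PathTerm.color c (lift n e x) = PathTerm.color c x :=
  hx.elim fun k hk => ((h.stage_lift hn k).1 x hk).2.1

theorem lift_symm_lift {x : PathTerm B} (hx : IsVertex n c R x) :
    lift n e.symm (lift n e x) = x :=
  hx.elim fun k hk => ((h.stage_lift hn k).1 x hk).2.2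

theorem completionAdj_lift {x y : PathTerm B} (hx : IsVertex n c R x) (hy : IsVertex n c R y) :
    CompletionAdj n c R x y ↔ CompletionAdj n c R' (lift n e x) (lift n e y) := by
  refine ⟨fun hxy => hxy.imp fun k => (h.stage_lift hn k).2 x y, fun hxy => ?_⟩
  have := hxy.imp fun k => (h.symm.stage_lift hn k).2 _ _
  rwa [h.lift_symm_lift hn hx, h.lift_symm_lift hn hy] at this

end ColorIso

end Lift

/-! ### The completion as a structure on ω, and recovery of the starting graph. -/

section Enumeration

variable {B : Type} [Countable B] [Infinite B] {n : ℕ} {c : B → Bool} {R R' : B → B → Prop}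

theorem infinite_index_isVertex (n : ℕ) (c : B → Bool) (R : B → B → Prop) :
    {m | ∃ x, IsVertex n c R x ∧ index x = m}.Infinite :=
  Set.infinite_of_injective_forall_mem (f := fun b : B => index (base b))
    (fun _ _ h => base_injective (index_injective h)) fun b => ⟨base b, ⟨0, b, rfl⟩, rfl⟩

/-- The increasing enumeration of the vertices of the free completion. -/
noncomputable def vertex (n : ℕ) (c : B → Bool) (R : B → B → Prop) (i : ℕ) : PathTerm B :=
  Classical.choose (Nat.nth_mem_of_infinite (infinite_index_isVertex n c R) i)

theorem isVertex_vertex (i : ℕ) : IsVertex n c R (vertex n c R i) :=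
  (Classical.choose_spec (Nat.nth_mem_of_infinite (infinite_index_isVertex n c R) i)).1

theorem index_vertex (i : ℕ) :
    index (vertex n c R i) = Nat.nth (fun m => ∃ x, IsVertex n c R x ∧ index x = m) i :=
  (Classical.choose_spec (Nat.nth_mem_of_infinite (infinite_index_isVertex n c R) i)).2

theorem vertex_injective : Function.Injective (vertex n c R) := by
  intro i j h
  have := congrArg index h
  rw [index_vertex, index_vertex] at this
  exact Nat.nth_injective (infinite_index_isVertex n c R) this

-- This replaces the choice in `vertex` by a count of the vertices of smaller index, which is what
-- makes the enumeration Borel in `R`.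
open Classical in
theorem vertex_eq_iff {i : ℕ} {x : PathTerm B} : vertex n c R i = x ↔
    IsVertex n c R x ∧
      Nat.count (fun m => ∃ x, IsVertex n c R x ∧ index x = m) (index x) = i := by
  constructor
  · rintro rfl
    refine ⟨isVertex_vertex i, ?_⟩
    rw [index_vertex, Nat.count_nth_of_infinite (infinite_index_isVertex n c R)]
  · rintro ⟨h1, rfl⟩
    apply index_injective
    rw [index_vertex]
    exact Nat.nth_count (p := fun m => ∃ x, IsVertex n c R x ∧ index x = m) ⟨x, h1, rfl⟩

theorem exists_vertex_eq {x : PathTerm B} (hx : IsVertex n c R x) : ∃ i, vertex n c R i = x := by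
  classical
  exact ⟨_, vertex_eq_iff.2 ⟨hx, rfl⟩⟩

open Classical in
/-- The free completion as a structure with domain `ω`. -/
noncomputable def completionCode (n : ℕ) (c : B → Bool) (R : B → B → Prop) : PointLineCode :=
  (fun i => color c (vertex n c R i),
    fun i j => decide (CompletionAdj n c R (vertex n c R i) (vertex n c R j)))

theorem completionCode_snd {i j : ℕ} : (completionCode n c R).2 i j = true ↔
    CompletionAdj n c R (vertex n c R i) (vertex n c R j) := by
  simp [completionCode]

theorem completionCode_iso (hn : 3 ≤ n) {e : Equiv.Perm B} (h : ColorIso c R R' e) :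
    (completionCode n c R).Iso (completionCode n c R') := by
  choose f hf using fun i => exists_vertex_eq (h.isVertex_lift hn (isVertex_vertex (R := R) i))
  choose g hg using fun i =>
    exists_vertex_eq (h.symm.isVertex_lift hn (isVertex_vertex (R := R') i))
  refine ⟨⟨f, g, fun i => ?_, fun i => ?_⟩, fun i => ?_, fun i j => ?_⟩
  · apply vertex_injective (n := n) (c := c) (R := R)
    rw [hg, hf, h.lift_symm_lift hn (isVertex_vertex i)]
  · apply vertex_injective (n := n) (c := c) (R := R')
    rw [hf, hg]
    exact h.symm.lift_symm_lift hn (isVertex_vertex i)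
  · show color c _ = color c (vertex n c R' (f i))
    rw [hf, h.color_lift hn (isVertex_vertex i)]
  · rw [Bool.eq_iff_iff, completionCode_snd, completionCode_snd]
    show _ ↔ CompletionAdj n c R' (vertex n c R' (f i)) (vertex n c R' (f j))
    rw [hf, hf]
    exact h.completionAdj_lift hn (isVertex_vertex i) (isVertex_vertex j)

theorem InCore.of_injective {V W : Type*} {E : V → V → Prop} {F : W → W → Prop} {f : V → W}
    (hf : Function.Injective f) (h : ∀ x y, E x y ↔ F (f x) (f y)) {x : V} (hx : InCore E x) :
    InCore F (f x) := by
  obtain ⟨S, hfin, hxS, hS⟩ := hx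
  refine ⟨f '' S, hfin.image f, ⟨x, hxS, rfl⟩, ?_⟩
  rintro _ ⟨u, hu, rfl⟩
  refine (hS u hu).trans ?_
  rw [← Set.ncard_image_of_injective _ hf]
  refine Set.ncard_le_ncard ?_ ((hfin.image f).subset fun y hy => hy.1)
  rintro _ ⟨v, ⟨hv, huv⟩, rfl⟩
  exact ⟨⟨v, hv, rfl⟩, (h _ _).1 huv⟩

/-- The range is closed under adjacency, so no degree is lost by pulling back. -/
theorem InCore.comap_injective {V W : Type*} {E : V → V → Prop} {F : W → W → Prop} {f : V → W}
    (hf : Function.Injective f) (h : ∀ x y, E x y ↔ F (f x) (f y))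
    (hr : ∀ x y, F x y → y ∈ Set.range f) {x : V} (hx : InCore F (f x)) : InCore E x := by
  obtain ⟨S, hfin, hxS, hS⟩ := hx
  refine ⟨f ⁻¹' S, hfin.preimage hf.injOn, hxS, fun u hu => ?_⟩
  refine (hS (f u) hu).trans ?_
  rw [← Set.ncard_image_of_injective _ hf]
  refine Set.ncard_le_ncard ?_ (((hfin.preimage hf.injOn).subset fun y hy => hy.1).image f)
  rintro y ⟨hy, huy⟩
  obtain ⟨v, rfl⟩ := hr _ _ huy
  exact ⟨v, ⟨hy, (h _ _).2 huy⟩, rfl⟩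

theorem IsPartialPolygon.inCore_completionCode_iff (h : IsPartialPolygon n c R)
    (hR : ∀ b, InCore R b) (i : ℕ) :
    InCore (fun i j => (completionCode n c R).2 i j = true) i ↔ ∃ b, vertex n c R i = base b := by
  rw [← h.inCore_completionAdj_iff hR]
  refine ⟨fun hi => hi.of_injective vertex_injective fun _ _ => completionCode_snd, fun hi =>
    InCore.comap_injective vertex_injective (fun _ _ => completionCode_snd) ?_ hi⟩
  intro x y hxy
  exact exists_vertex_eq (h.isVertex_left (h.completionAdj_symm hxy))

/-- The original graph can be recovered from its free completion. -/
theorem exists_equiv_of_completionCode_iso (h : IsPartialPolygon n c R)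
    (h' : IsPartialPolygon n c R') (hR : ∀ b, InCore R b) (hR' : ∀ b, InCore R' b)
    (hiso : (completionCode n c R).Iso (completionCode n c R')) :
    ∃ e : Equiv.Perm B, ∀ a b, R a b ↔ R' (e a) (e b) := by
  -- The sorts are discarded: incidence alone determines the core.
  obtain ⟨τ, -, hτ⟩ := hiso
  have hτ1 : ∀ i j, (completionCode n c R).2 i j = true ↔
      (completionCode n c R').2 (τ i) (τ j) = true := fun i j => by rw [hτ]
  have hτ2 : ∀ i j, (completionCode n c R').2 i j = true ↔
      (completionCode n c R).2 (τ.symm i) (τ.symm j) = true := fun i j => by simp [hτ]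
  choose p hp using fun b => exists_vertex_eq (n := n) (c := c) (R := R) (x := base b) ⟨0, b, rfl⟩
  choose q hq using fun b => exists_vertex_eq (n := n) (c := c) (R := R') (x := base b) ⟨0, b, rfl⟩
  choose f hf using fun b => (h'.inCore_completionCode_iff hR' (τ (p b))).1
    (((h.inCore_completionCode_iff hR (p b)).2 ⟨b, hp b⟩).of_injective τ.injective hτ1)
  choose g hg using fun b => (h.inCore_completionCode_iff hR (τ.symm (q b))).1
    (((h'.inCore_completionCode_iff hR' (q b)).2 ⟨b, hq b⟩).of_injective τ.symm.injective hτ2)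
  have hqf : ∀ b, q (f b) = τ (p b) := fun b =>
    vertex_injective (n := n) (c := c) (R := R') ((hq _).trans (hf b).symm)
  have hpg : ∀ b, p (g b) = τ.symm (q b) := fun b =>
    vertex_injective (n := n) (c := c) (R := R) ((hp _).trans (hg b).symm)
  refine ⟨⟨f, g, fun b => ?_, fun b => ?_⟩, fun a b => ?_⟩
  · apply base_injective
    rw [← hp, hpg, hqf, Equiv.symm_apply_apply, hp]
  · apply base_injective
    rw [← hq, hqf, hpg, Equiv.apply_symm_apply, hq]
  · show _ ↔ R' (f a) (f b)
    rw [← h.completionAdj_base, ← h'.completionAdj_base, ← hf, ← hf, ← hp, ← hp,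
      ← completionCode_snd, ← completionCode_snd, hτ1]

theorem exists_isPath_of_injOn {V : Type*} {G : SimpleGraph V} {f : ℕ → V} (m : ℕ)
    (hf : Set.InjOn f {i | i < m + 1}) (ha : ∀ i < m, G.Adj (f i) (f (i + 1))) :
    ∃ p : G.Walk (f 0) (f m), p.IsPath ∧ p.length = m := by
  have : ∀ k ≤ m, ∃ p : G.Walk (f 0) (f k), p.support = (List.range (k + 1)).map f := by
    intro k
    induction k with
    | zero => exact fun _ => ⟨.nil, by simp⟩
    | succ k ih =>
      intro hk
      obtain ⟨p, hp⟩ := ih (by omega)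
      refine ⟨p.concat (ha k (by omega)), ?_⟩
      rw [SimpleGraph.Walk.support_concat, hp, List.range_succ (n := k + 1)]
      simp
  obtain ⟨p, hp⟩ := this m le_rfl
  refine ⟨p, ?_, ?_⟩
  · rw [SimpleGraph.Walk.isPath_def, hp]
    exact List.Nodup.map_on (fun x hx y hy hxy => hf (List.mem_range.1 hx) (List.mem_range.1 hy) hxy)
      List.nodup_range
  · have := congrArg List.length hp
    simpa using this

/-- The free completion is a generalised polygon. -/
theorem IsPartialPolygon.completionCode_mem (h : IsPartialPolygon n c R) {f : ℕ → B}
    (hf : Set.InjOn f {i | i < n + 1 + 1}) (ha : ∀ i < n + 1, R (f i) (f (i + 1))) :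
    completionCode n c R ∈ generalisedPolygonsOnNat n := by
  have hn := h.three_le
  let G : SimpleGraph ℕ :=
    { Adj := fun i j => CompletionAdj n c R (vertex n c R i) (vertex n c R j)
      symm := ⟨fun _ _ hij => h.completionAdj_symm hij⟩
      loopless := ⟨fun _ hi => h.completionAdj_color_ne hi rfl⟩ }
  have hcol : ∀ i j, G.Adj i j → color c (vertex n c R i) ≠ color c (vertex n c R j) :=
    fun i j hij => h.completionAdj_color_ne hij
  choose! g hg using fun x (hx : IsVertex n c R x) => exists_vertex_eq hx
  have hlong : LongPeriods G.Adj (2 * n) := fun k w hk hw hb hp =>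
    h.completionAdj_longPeriods k (fun i => vertex n c R (w i)) hk hw
      (fun i hi => hb i (vertex_injective hi)) fun i => by rw [hp]
  have hgadj : ∀ x y, CompletionAdj n c R x y → G.Adj (g x) (g y) := fun x y hxy => by
    show CompletionAdj n c R (vertex n c R (g x)) (vertex n c R (g y))
    rwa [hg x (h.isVertex_left hxy), hg y (h.isVertex_left (h.completionAdj_symm hxy))]
  have hgv : ∀ i, g (vertex n c R i) = i := fun i =>
    vertex_injective (hg _ (isVertex_vertex i))
  have hbase : ∀ b, IsVertex n c R (base b) := fun b => ⟨0, b, rfl⟩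
  obtain ⟨p, hp, hpl⟩ := exists_isPath_of_injOn (G := G) (f := fun i => g (base (f i))) (n + 1)
    (fun i hi j hj hij => hf hi hj (base_injective (by
      have := congrArg (vertex n c R) hij
      rwa [hg _ (hbase _), hg _ (hbase _)] at this)))
    (fun i hi => hgadj _ _ (h.completionAdj_base.2 (ha i hi)))
  obtain ⟨h1, h2⟩ := egirth_eq_and_ediam_eq (by omega) _ hcol hlong (fun i j => by
    have := (h.within_completionAdj (isVertex_vertex i) (isVertex_vertex j)).map g hgadj
    rw [hgv, hgv] at this
    exact this.exists_walk) hp hpl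
  refine ⟨G, fun i j => completionCode_snd.symm, ⟨disjoint_compl_right, fun i j hij => ?_⟩, h1, h2⟩
  have := hcol i j hij
  simp only [Set.mem_ofPred_eq, Set.mem_compl_iff, completionCode]
  revert this
  cases color c (vertex n c R i) <;> cases color c (vertex n c R j) <;> simp

end Enumeration

/-! ### The completion depends on the graph in a Borel way. -/

section Measurability

variable {B : Type} [Countable B] {n : ℕ} {c : B → Bool} {X : Type*} [MeasurableSpace X]
  {R : X → B → B → Prop}

theorem measurable_within {V : Type*} [Countable V] {E : X → V → V → Prop}
    (hE : ∀ x y, Measurable fun z => E z x y) (k : ℕ) (x y : V) :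
    Measurable fun z => Within (E z) k x y := by
  induction k generalizing x with
  | zero => exact measurable_const
  | succ k ih => exact measurable_const.or (.exists fun u => (hE x u).and (ih u))

/-- The names do not depend on the graph, so each stage is defined by countable quantifiers over the
previous one. -/
theorem measurable_stage (hR : ∀ a b, Measurable fun z => R z a b) (k : ℕ) :
    (∀ x, Measurable fun z => (stage n c (R z) k).1 x) ∧
      ∀ x y, Measurable fun z => (stage n c (R z) k).2 x y := by
  induction k with
  | zero =>
    exact ⟨fun x => measurable_const, fun x y => .exists fun a => .exists fun b =>
      (hR a b).and measurable_const⟩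
  | succ k ih =>
    obtain ⟨h1, h2⟩ := ih
    have hQ : ∀ x y, Measurable fun z =>
        Far n (color c) (stage n c (R z) k).1 (stage n c (R z) k).2 x y := fun x y =>
      (h1 x).and ((h1 y).and (measurable_const.and (measurable_within h2 _ x y).not))
    refine ⟨fun x => (h1 x).or (.exists fun a => .exists fun b => .exists fun i =>
      (hQ a b).and measurable_const), fun x y => (h2 x y).or (.exists fun a => .exists fun b =>
      .exists fun i => (hQ a b).and measurable_const)⟩

theorem measurable_completionCode [Infinite B] (hR : ∀ a b, Measurable fun z => R z a b) :
    Measurable fun z => completionCode n c (R z) := by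
  classical
  have hV : ∀ x, Measurable fun z => IsVertex n c (R z) x := fun x =>
    .exists fun k => (measurable_stage hR k).1 x
  have hE : ∀ x y, Measurable fun z => CompletionAdj n c (R z) x y := fun x y =>
    .exists fun k => (measurable_stage hR k).2 x y
  have hcount : ∀ m, Measurable fun z =>
      Nat.count (fun m => ∃ x, IsVertex n c (R z) x ∧ index x = m) m := by
    intro m
    induction m with
    | zero => simp
    | succ m ih =>
      simp only [Nat.count_succ]
      refine ih.add (Measurable.ite ?_ measurable_const measurable_const)
      exact measurableSet_setOfPred.2 (.exists fun x => (hV x).and measurable_const)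
  have hvertex : ∀ i x, Measurable fun z => vertex n c (R z) i = x := fun i x => by
    simp only [vertex_eq_iff]
    exact (hV x).and ((hcount _).eq_const i)
  refine Measurable.prodMk (measurable_pi_lambda _ fun i => ?_)
    (measurable_pi_lambda _ fun i => measurable_pi_lambda _ fun j => ?_)
  · refine measurable_to_bool (measurableSet_setOfPred.2 ?_)
    -- The value of `vertex`, which varies with `z`, is replaced by a countable quantifier over
    -- names.
    have : (fun z => color c (vertex n c (R z) i) ∈ ({true} : Set Bool)) = fun z =>
        ∃ x, vertex n c (R z) i = x ∧ color c x = true := by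
      ext z; simp
    rw [this]
    exact .exists fun x => (hvertex i x).and measurable_const
  · refine measurable_to_bool (measurableSet_setOfPred.2 ?_)
    have : (fun z => decide (CompletionAdj n c (R z) (vertex n c (R z) i) (vertex n c (R z) j)) ∈
        ({true} : Set Bool)) = fun z => ∃ x y, vertex n c (R z) i = x ∧
          vertex n c (R z) j = y ∧ CompletionAdj n c (R z) x y := by
      ext z; simp
    rw [this]
    exact .exists fun x => .exists fun y => (hvertex i x).and ((hvertex j y).and (hE x y))

end Measurability

/-! ### The polygon of a graph, and the theorem. -/

section Main

variable {n : ℕ}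

instance : Infinite (Base n) :=
  Infinite.of_injective (fun a : ℕ => ((.pt a, Base.root n) : Base n)) fun a b h => by
    simpa using h

theorem Base.isPartialPolygon (hn : 3 ≤ n) (R : ℕ → ℕ → Prop) :
    IsPartialPolygon n Base.color (Base.Adj R : Base n → Base n → Prop) where
  three_le := hn
  symm _ _ h := h.symm
  color_ne _ _ h := h.color_ne
  exists_adj x := by
    obtain ⟨S, -, hx, hS⟩ := Base.inCore (R := R) (by omega) x
    have : {v | v ∈ S ∧ Base.Adj R x v}.ncard ≠ 0 := by
      have := hS x hx
      omega
    obtain ⟨v, hv⟩ := Set.nonempty_of_ncard_ne_zero this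
    exact ⟨v, hv.2⟩
  longPeriods := Base.longPeriods_adj n R

/-- The generalised `n`-gon associated with a graph with domain `ω`. -/
noncomputable def polygonCode (n : ℕ) (E : RelCode) : PointLineCode :=
  completionCode n Base.color (Base.Adj (fun a b => E a b = true) : Base n → Base n → Prop)

theorem measurable_polygonCode : Measurable (polygonCode n) :=
  measurable_completionCode fun x y => Base.measurable_adj x y fun a b =>
    Measurable.eq_const (f := fun E : RelCode => E a b) (by fun_prop) true

theorem polygonCode_mem (hn : 3 ≤ n) (E : RelCode) :
    polygonCode n E ∈ generalisedPolygonsOnNat n := by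
  -- A path of length n + 1 is needed whatever the graph is; the chain from 0 to 0 is always present
  -- and its 2n + 1 vertices suffice.
  refine (Base.isPartialPolygon hn _).completionCode_mem
    (f := fun i => ((.mid 0 0 (Fin.ofNat (2 * n + 1) i), Base.root n) : Base n)) ?_ ?_
  · intro i hi j hj h
    simp only [Prod.mk.injEq, Junction.mid.injEq, true_and, and_true, Fin.ext_iff,
      Fin.ofNat] at h
    have hi : i < n + 1 + 1 := hi
    have hj : j < n + 1 + 1 := hj
    rwa [Nat.mod_eq_of_lt (by omega), Nat.mod_eq_of_lt (by omega)] at h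
  · intro i hi
    refine Or.inr ⟨Or.inl ⟨rfl, rfl, ?_⟩, rfl, rfl⟩
    simp only [Fin.ofNat]
    rw [Nat.mod_eq_of_lt (by omega), Nat.mod_eq_of_lt (by omega)]

theorem polygonCode_iso_iff (hn : 3 ≤ n) {E F : RelCode} (hE : E ∈ graphsOnNat)
    (hF : F ∈ graphsOnNat) : E.Iso F ↔ (polygonCode n E).Iso (polygonCode n F) := by
  constructor
  · rintro ⟨σ, hσ⟩
    have h : ∀ a b, E a b = true ↔ F (σ a) (σ b) = true := fun a b => by rw [hσ]
    exact completionCode_iso hn (e := Base.perm σ) ⟨Base.adj_perm h, Base.color_perm σ⟩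
  · intro h
    obtain ⟨e, he⟩ := exists_equiv_of_completionCode_iso (Base.isPartialPolygon hn _)
      (Base.isPartialPolygon hn _) (Base.inCore (by omega)) (Base.inCore (by omega)) h
    obtain ⟨σ, hσ⟩ := Base.exists_perm_of_equiv (fun a b h => by rwa [hE.2 b a])
      (fun a => by simp [hE.1 a]) (fun a b h => by rwa [hF.2 b a]) (fun a => by simp [hF.1 a]) e he
    exact ⟨σ, fun a b => Bool.eq_iff_iff.2 (hσ a b)⟩

end Main

theorem mainTheorem2 (n : ℕ) (hn : 3 ≤ n) :
    IsBorelComplete (generalisedPolygonsOnNat n) PointLineCode.Iso where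
  measurableSet := measurableSet_generalisedPolygonsOnNat (by omega)
  graphs_reducible := ⟨fun E => ⟨polygonCode n E.1, polygonCode_mem hn E.1⟩,
    (measurable_polygonCode.comp measurable_subtype_coe).subtype_mk,
    fun E F => polygonCode_iso_iff hn E.2 F.2⟩
  reducible_graphs := generalisedPolygons_reducible_graphs (by omega)
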